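/- Let $L,T>0$, $\sigma\in\mathbb R$, and let $Q=(0,L]^2$. Let $(u,p)$ be a smooth classical solution on $[0,T]$ of the two-dimensional incompressible Navier–Stokes equations with negative direction of time, with $L$-periodic data in each coordinate of $x\in\mathbb R^2$: $$\frac{\partial u}{\partial t}+\frac{\sigma^2}{2}\Delta u-(u,\nabla)u-\nabla p+f=0\quad(0\le t<T),\qquad \operatorname{div}u=0,\qquad u(T,x)=\varphi(x),$$ where $u$, $p$, $f$ are $L$-periodic in $x^1$ and $x^2$, $\int_Q u(t,x)\,dx=0$ for all $t\in[0,T]$, $u$ is $C^3$ on $[0,T]\times\mathbb R^2$, and $p(t,\cdot)$, $f(t,\cdot)$ are $C^2$ and $C^1$ respectively for each $t$. Write $\operatorname{curl}v=\partial v^2/\partial x^1-\partial v^1/\partial x^2$, $\omega=\operatorname{curl}u$ and $g=\operatorname{curl}f$. For a real $L$-periodic function $w$ on $\mathbb R^2$ with Fourier coefficients $w_{\mathbf n}=L^{-2}\int_Q w(x)e^{-i(2\pi/L)(\mathbf n,x)}dx$ let $$Uw(x)=\frac{Li}{2\pi}\sum_{\mathbf n\in\mathbb Z^2,\ \mathbf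 n\ne0}\frac{1}{|\mathbf n|^2}\,w_{\mathbf n}\,e^{i(2\pi/L)(\mathbf n,x)}\begin{bmatrix}n^2\\-n^1\end{bmatrix},\qquad \mathbf n=(n^1,n^2),$$ be the periodic Biot–Savart operator. For an integer $N\ge1$ put $h=T/N$ and $t_k=kh$. For $0\le k<N$ let $\tilde\omega$ be a classical solution, $L$-periodic in $x^1$ and $x^2$, of the linear problem with frozen velocity $$\frac{\partial\tilde\omega}{\partial t}-(\hat u,\nabla)\tilde\omega+\frac{\sigma^2}{2}\Delta\tilde\omega+g=0\quad(t_k\le t<t_{k+1}),\qquad \hat u(x)=u(t_{k+1},x),\qquad \tilde\omega(t_{k+1},x)=\omega(t_{k+1},x),$$ that is, $\tilde\omega$ is continuous on $[t_k,t_{k+1}]\times\mathbb R^2$ and, for $t_k\le t<t_{k+1}$, differentiable in $t$ (one-sidedly at $t_k$) and $C^2$ in $x$. Let $\tilde u(t,x)=U\tilde\omega(t,x)$, $\delta_\omega=\omega-\tilde\omega$ and $\delta_u=u-\tilde u$. Then for all $t\in[t_k,t_{k+1}]$ the series defining $U\tilde\omega(t,\cdot)$ converges absolutely at every point, with real sum,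 $\delta_u(t,\cdot)=U\delta_\omega(t,\cdot)$, the function $\delta_u(t,\cdot)$ belongs to $L^2(Q)$, and $$\|\delta_u(t,\cdot)\|_{L^2(Q)}\le K h^2,\qquad t_k\le t\le t_{k+1},$$ where $K>0$ may depend on the Navier–Stokes solution and its data ($u,p,f,\varphi,\sigma,L,T$) but not on $N$, $k$, $t$ or $\tilde\omega$. -/

import Mathlib

open MeasureTheory Set
open scoped ENNReal

noncomputable section

namespace PeriodicNS

/-- The plane `ℝ²` with its Euclidean norm. -/
abbrev Plane : Type := EuclideanSpace ℝ (Fin 2)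

/-- The canonical basis vectors `e₁, e₂` of `ℝ²`. -/
def basisVec (i : Fin 2) : Plane := EuclideanSpace.single i 1

/-- The partial derivative `∂F/∂xⁱ` of a scalar function of `x ∈ ℝ²`. -/
def pd (i : Fin 2) (F : Plane → ℝ) (x : Plane) : ℝ := fderiv ℝ F x (basisVec i)

/-- The Laplacian `∑ᵢ ∂²F/(∂xⁱ)²`. -/
def lap (F : Plane → ℝ) (x : Plane) : ℝ := ∑ i, pd i (pd i F) x

/-- The directional derivative `(v, ∇)F = ∑ⱼ vʲ ∂F/∂xʲ`. -/
def advect (v : Plane → Plane) (F : Plane → ℝ) (x : Plane) : ℝ := ∑ j, v x j * pd j F x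

/-- The divergence of a plane vector field. -/
def div (v : Plane → Plane) (x : Plane) : ℝ := ∑ i, pd i (fun y => v y i) x

/-- The scalar curl `∂v²/∂x¹ - ∂v¹/∂x²` of a plane vector field. -/
def curl (v : Plane → Plane) (x : Plane) : ℝ :=
  pd 0 (fun y => v y 1) x - pd 1 (fun y => v y 0) x

/-- `F(x + L eᵢ) = F(x)` for `i = 1, 2`. -/
def IsPeriodic {α : Type*} (L : ℝ) (F : Plane → α) : Prop :=
  ∀ (i : Fin 2) (x : Plane), F (x + L • basisVec i) = F x

/-- The period cell `Q = (0, L]²`. -/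
def cell (L : ℝ) : Set Plane := {x | ∀ i, x i ∈ Ioc 0 L}

/-- The exponential `exp(i (2π/L) (n, x))`, `n ∈ ℤ²`. -/
def expMode (L : ℝ) (n : Fin 2 → ℤ) (x : Plane) : ℂ :=
  Complex.exp (Complex.I * ((2 * Real.pi / L * ∑ j, (n j : ℝ) * x j : ℝ) : ℂ))

/-- The Fourier coefficient `wₙ = L⁻² ∫_Q w(x) exp(-i (2π/L) (n, x)) dx`. -/
def fourierCoef (L : ℝ) (w : Plane → ℝ) (n : Fin 2 → ℤ) : ℂ :=
  ((L ^ 2)⁻¹ : ℂ) * ∫ x in cell L, (w x : ℂ) * expMode L (-n) x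

/-- The term with index `n` of the periodic Biot–Savart series,
`(L i / 2π) |n|⁻² exp(i (2π/L) (n, x)) wₙ (n², -n¹)`.
The term with `n = 0` vanishes, as `(n², -n¹) = 0` there. -/
def biotSavartTerm (L : ℝ) (w : Plane → ℝ) (x : Plane) (n : Fin 2 → ℤ) (i : Fin 2) : ℂ :=
  (L * Complex.I / (2 * Real.pi)) * (1 / ((n 0 : ℂ) ^ 2 + (n 1 : ℂ) ^ 2)) * expMode L n x *
    fourierCoef L w n * (![(n 1 : ℂ), -(n 0 : ℂ)] i)

/-- The periodic Biot–Savart operator `U`, sending a scalar vorticity `w` to a velocity field.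
For real `w` the terms `n` and `-n` of the series are complex conjugates of each other, so that its
sum is real. -/
def biotSavart (L : ℝ) (w : Plane → ℝ) (x : Plane) : Plane :=
  !₂[(∑' n, biotSavartTerm L w x n 0).re, (∑' n, biotSavartTerm L w x n 1).re]

/-- `(u, p)` is a smooth classical solution on `[0, T]`, with zero space average, of the spatially
`L`-periodic Navier–Stokes equations with negative direction of time
`∂u/∂t + (σ²/2) Δu - (u, ∇)u - ∇p + f = 0`, `div u = 0`, `u(T, ·) = φ`.
The time derivative at `t = 0` is one-sided. -/
structure IsNSSolution (σ L T : ℝ) (f : ℝ → Plane → Plane) (φ : Plane → Plane)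
    (u : ℝ → Plane → Plane) (p : ℝ → Plane → ℝ) : Prop where
  smooth_u : ContDiffOn ℝ 3 (fun z : ℝ × Plane => u z.1 z.2) (Icc 0 T ×ˢ univ)
  smooth_p : ∀ t ∈ Icc 0 T, ContDiff ℝ 2 (p t)
  smooth_f : ∀ t ∈ Icc 0 T, ContDiff ℝ 1 (f t)
  periodic_u : ∀ t ∈ Icc 0 T, IsPeriodic L (u t)
  periodic_p : ∀ t ∈ Icc 0 T, IsPeriodic L (p t)
  periodic_f : ∀ t ∈ Icc 0 T, IsPeriodic L (f t)
  momentum : ∀ t ∈ Ico 0 T, ∀ (x : Plane) (i : Fin 2),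
    derivWithin (fun s => u s x i) (Icc 0 T) t + σ ^ 2 / 2 * lap (fun y => u t y i) x
      - advect (u t) (fun y => u t y i) x - pd i (p t) x + f t x i = 0
  div_free : ∀ t ∈ Icc 0 T, ∀ x, div (u t) x = 0
  terminal : ∀ x, u T x = φ x
  zero_mean : ∀ t ∈ Icc 0 T, ∀ i, ∫ x in cell L, u t x i = 0

/-- `w` is a classical solution on `[a, b]` of the spatially `L`-periodic linear parabolic problem
for the vorticity in which the velocity is frozen at the field `v`,
`∂w/∂t - (v, ∇)w + (σ²/2) Δw + g = 0` for `a ≤ t < b`, with `w(b, ·) = w₁`.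
The time derivative at `t = a` is one-sided. -/
structure IsFrozenSolution (σ L a b : ℝ) (v : Plane → Plane) (g : ℝ → Plane → ℝ)
    (w₁ : Plane → ℝ) (w : ℝ → Plane → ℝ) : Prop where
  continuous : ContinuousOn (fun z : ℝ × Plane => w z.1 z.2) (Icc a b ×ˢ univ)
  smooth_space : ∀ t ∈ Ico a b, ContDiff ℝ 2 (w t)
  smooth_time : ∀ t ∈ Ico a b, ∀ x, DifferentiableWithinAt ℝ (fun s => w s x) (Icc a b) t
  periodic : ∀ t ∈ Icc a b, IsPeriodic L (w t)
  equation : ∀ t ∈ Ico a b, ∀ x,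
    derivWithin (fun s => w s x) (Icc a b) t - advect v (w t) x + σ ^ 2 / 2 * lap (w t) x
      + g t x = 0
  terminal : ∀ x, w b x = w₁ x

/-- The grid point `t_k = k h` of the uniform partition of `[0, T]` with step `h = T / N`. -/
def gridTime (T : ℝ) (N k : ℕ) : ℝ := k * (T / N)

end PeriodicNS

end

open MeasureTheory Set
open scoped ENNReal

namespace PeriodicNS

/-! Taking the curl of the momentum equation removes the pressure and, in two dimensions with `div u
= 0`, leaves no stretching term (`vorticity_equation`). Subtracting the frozen equation, the error
`δ_ω` solves a linear backward parabolic problem with velocity `u(t_{k+1})`, zero terminal value and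
source `(u(t) - u(t_{k+1}), ∇)ω`. Since `u` is Lipschitz in time and `∇ω` is bounded, both uniformly
in space by periodicity and compactness, this source is `O(h)`.

The problem has no zeroth-order term, so the maximum principle (`le_of_backward_parabolic`) bounds
`δ_ω` by the size of the source times the remaining time. This is `O(h²)` in the supremum norm, with
a constant independent of the step (`exists_vorticity_error`). Only `σ² / 2 ≥ 0` enters, so `σ = 0`
is covered.

The passage to velocities is Fourier analysis on the torus. The velocity `u` has zero mean and zero
divergence, so `Uω = u` (`biotSavart_curl`), whence `δ_u = Uδ_ω`. The multiplier of `U` is bounded,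
and Parseval bounds `Uδ_ω` in `L²` by the supremum of `δ_ω` (`memLp_biotSavart`). -/

/-- The space-time slab `[0, T] × ℝ²`. -/
abbrev slab (T : ℝ) : Set (ℝ × Plane) := Icc 0 T ×ˢ univ

/-- The directional derivative within the slab `[0, T] × ℝ²` of a function of `(t, x)`. -/
noncomputable def slabDeriv (T : ℝ) (v : ℝ × Plane) (G : ℝ × Plane → ℝ) (z : ℝ × Plane) : ℝ :=
  fderivWithin ℝ G (slab T) z v

/-! ### Calculus on the closed slab, with one-sided time derivatives at its two ends. -/

section Slab

variable {T : ℝ} {G H : ℝ × Plane → ℝ} {v w : ℝ × Plane} {z : ℝ × Plane}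

lemma uniqueDiffOn_slab (hT : 0 < T) : UniqueDiffOn ℝ (slab T) :=
  (uniqueDiffOn_Icc hT).prod uniqueDiffOn_univ

/-- Second derivatives within a set are symmetric at points of the set that are limits of interior
points; `slabDeriv_comm` needs this on the boundary times. -/
lemma slab_subset_closure_interior (hT : 0 < T) : slab T ⊆ closure (interior (slab T)) := by
  rw [interior_prod_eq, interior_Icc, interior_univ, closure_prod_eq, closure_Ioo hT.ne,
    closure_univ]

lemma contDiffOn_slabDeriv (hT : 0 < T) {m n : ℕ} (hG : ContDiffOn ℝ n G (slab T))
    (hmn : m + 1 ≤ n) (v : ℝ × Plane) : ContDiffOn ℝ m (slabDeriv T v G) (slab T) :=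
  (hG.fderivWithin (uniqueDiffOn_slab hT) (by exact_mod_cast hmn)).clm_apply contDiffOn_const

lemma slabDeriv_congr (h : EqOn G H (slab T)) (hz : z ∈ slab T) :
    slabDeriv T v G z = slabDeriv T v H z := by
  rw [slabDeriv, slabDeriv, fderivWithin_congr h (h hz)]

lemma slabDeriv_sub (hT : 0 < T) (hG : DifferentiableOn ℝ G (slab T))
    (hH : DifferentiableOn ℝ H (slab T)) (hz : z ∈ slab T) :
    slabDeriv T v (fun y => G y - H y) z = slabDeriv T v G z - slabDeriv T v H z := by
  rw [slabDeriv, fderivWithin_fun_sub (uniqueDiffOn_slab hT z hz) (hG z hz) (hH z hz)]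
  rfl

lemma slabDeriv_comm (hT : 0 < T) (hG : ContDiffOn ℝ 2 G (slab T)) (hz : z ∈ slab T) :
    slabDeriv T v (slabDeriv T w G) z = slabDeriv T w (slabDeriv T v G) z := by
  have hS := uniqueDiffOn_slab hT
  have hd : DifferentiableWithinAt ℝ (fderivWithin ℝ G (slab T)) (slab T) z :=
    ((hG.fderivWithin (m := 1) hS (by norm_num)).differentiableOn (by norm_num)) z hz
  have key : ∀ a b : ℝ × Plane, slabDeriv T a (slabDeriv T b G) z
      = fderivWithin ℝ (fderivWithin ℝ G (slab T)) (slab T) z a b := by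
    intro a b
    have h := hd.hasFDerivWithinAt.clm_apply (hasFDerivWithinAt_const b z (slab T))
    change fderivWithin ℝ (fun y => fderivWithin ℝ G (slab T) y b) (slab T) z a = _
    rw [h.fderivWithin (hS z hz)]
    simp
  rw [key, key]
  exact (hG z hz).isSymmSndFDerivWithinAt (by simp) hS
    (slab_subset_closure_interior hT hz) hz v w

lemma hasFDerivAt_slice (hG : DifferentiableOn ℝ G (slab T)) {t : ℝ} (ht : t ∈ Icc 0 T)
    (x : Plane) : HasFDerivAt (fun y => G (t, y))
      ((fderivWithin ℝ G (slab T) (t, x)).comp (ContinuousLinearMap.inr ℝ ℝ Plane)) x := by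
  have h := (hG (t, x) ⟨ht, mem_univ _⟩).hasFDerivWithinAt
  rw [← hasFDerivWithinAt_univ]
  exact h.comp (f := fun y : Plane => (t, y)) x (hasFDerivAt_prodMk_right t x).hasFDerivWithinAt
    (fun y _ => ⟨ht, mem_univ _⟩)

lemma pd_slice (hG : DifferentiableOn ℝ G (slab T)) {t : ℝ} (ht : t ∈ Icc 0 T) (x : Plane)
    (i : Fin 2) : pd i (fun y => G (t, y)) x = slabDeriv T (0, basisVec i) G (t, x) := by
  rw [pd, (hasFDerivAt_slice hG ht x).fderiv]
  simp [slabDeriv]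

lemma contDiff_slice {n : WithTop ℕ∞} (hG : ContDiffOn ℝ n G (slab T)) {t : ℝ}
    (ht : t ∈ Icc 0 T) : ContDiff ℝ n (fun y => G (t, y)) := by
  rw [← contDiffOn_univ]
  exact hG.comp (contDiff_prodMk_right t).contDiffOn (fun y _ => ⟨ht, mem_univ _⟩)

lemma hasDerivWithinAt_slice (hG : DifferentiableOn ℝ G (slab T)) {t : ℝ} (ht : t ∈ Icc 0 T)
    (x : Plane) : HasDerivWithinAt (fun s => G (s, x)) (slabDeriv T (1, 0) G (t, x))
      (Icc 0 T) t := by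
  have h := (hG (t, x) ⟨ht, mem_univ _⟩).hasFDerivWithinAt
  have hm : MapsTo (fun s : ℝ => (s, x)) (Icc 0 T) (slab T) := fun s hs => ⟨hs, mem_univ _⟩
  have h2 := (h.comp (f := fun s : ℝ => (s, x)) t
    (hasFDerivAt_prodMk_left t x).hasFDerivWithinAt hm).hasDerivWithinAt
  simp only [ContinuousLinearMap.coe_comp, Function.comp_apply,
    ContinuousLinearMap.inl_apply] at h2
  exact h2

end Slab

/-- The expression is `f` solved from the momentum equation: `A` stands for the time derivative, `P`
and `Q` for the second derivatives, the two products for advection and `q` for the pressure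
gradient. -/
lemma pd_combination {A P Q a b c d q : Plane → ℝ} (ν : ℝ) (j : Fin 2) (x : Plane)
    (hA : DifferentiableAt ℝ A x) (hP : DifferentiableAt ℝ P x) (hQ : DifferentiableAt ℝ Q x)
    (ha : DifferentiableAt ℝ a x) (hb : DifferentiableAt ℝ b x) (hc : DifferentiableAt ℝ c x)
    (hd : DifferentiableAt ℝ d x) (hq : DifferentiableAt ℝ q x) :
    pd j (fun y => -A y - ν * (P y + Q y) + (a y * b y + c y * d y) + q y) x =
      -pd j A x - ν * (pd j P x + pd j Q x) + (pd j a x * b x + a x * pd j b x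
        + (pd j c x * d x + c x * pd j d x)) + pd j q x := by
  have h := (((hA.hasFDerivAt.neg.sub ((hP.hasFDerivAt.add hQ.hasFDerivAt).const_mul ν)).add
    ((ha.hasFDerivAt.mul hb.hasFDerivAt).add (hc.hasFDerivAt.mul hd.hasFDerivAt))).add
    hq.hasFDerivAt)
  have h' : HasFDerivAt (fun y => -A y - ν * (P y + Q y) + (a y * b y + c y * d y) + q y) _ x := h
  rw [pd, h'.fderiv]
  simp [pd]
  ring

lemma pd_pd_comm {q : Plane → ℝ} (hq : ContDiff ℝ 2 q) (i j : Fin 2) (x : Plane) :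
    pd i (pd j q) x = pd j (pd i q) x := by
  have hd : DifferentiableAt ℝ (fderiv ℝ q) x :=
    (hq.fderiv_right (m := 1) (by norm_num)).differentiable (by norm_num) x
  have key : ∀ a b : Fin 2, pd a (pd b q) x
      = fderiv ℝ (fderiv ℝ q) x (basisVec a) (basisVec b) := by
    intro a b
    have h := hd.hasFDerivAt.clm_apply (hasFDerivAt_const (basisVec b) x)
    change fderiv ℝ (fun y => fderiv ℝ q y (basisVec b)) x (basisVec a) = _
    rw [h.fderiv]
    simp
  rw [key, key]
  exact (hq.contDiffAt.isSymmSndFDerivAt (by simp)) _ _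

lemma contDiff_pd {n : ℕ} {q : Plane → ℝ} (hq : ContDiff ℝ (n + 1) q) (i : Fin 2) :
    ContDiff ℝ n (pd i q) :=
  (hq.fderiv_right le_rfl).clm_apply contDiff_const

/-! ### The vorticity equation. -/

section Vorticity

variable {σ L T : ℝ} {f : ℝ → Plane → Plane} {φ : Plane → Plane} {u : ℝ → Plane → Plane}
  {p : ℝ → Plane → ℝ}

/-- The vorticity, as a function on space-time, written with derivatives within the slab. -/
noncomputable def slabVorticity (T : ℝ) (u : ℝ → Plane → Plane) (z : ℝ × Plane) : ℝ :=
  slabDeriv T (0, basisVec 0) (fun z => u z.1 z.2 1) z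
    - slabDeriv T (0, basisVec 1) (fun z => u z.1 z.2 0) z

lemma IsNSSolution.contDiffOn_coord (hu : IsNSSolution σ L T f φ u p) (i : Fin 2) :
    ContDiffOn ℝ 3 (fun z : ℝ × Plane => u z.1 z.2 i) (slab T) :=
  (EuclideanSpace.proj (𝕜 := ℝ) i).contDiff.comp_contDiffOn hu.smooth_u

lemma IsNSSolution.contDiffOn_slabVorticity (hT : 0 < T) (hu : IsNSSolution σ L T f φ u p) :
    ContDiffOn ℝ 2 (slabVorticity T u) (slab T) :=
  (contDiffOn_slabDeriv hT (m := 2) (n := 3) (hu.contDiffOn_coord 1) le_rfl _).sub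
    (contDiffOn_slabDeriv hT (m := 2) (n := 3) (hu.contDiffOn_coord 0) le_rfl _)

lemma IsNSSolution.curl_eq (hu : IsNSSolution σ L T f φ u p)
    {t : ℝ} (ht : t ∈ Icc 0 T) : curl (u t) = fun x => slabVorticity T u (t, x) := by
  funext x
  rw [curl, slabVorticity,
    ← pd_slice ((hu.contDiffOn_coord 1).differentiableOn (by norm_num)) ht x 0,
    ← pd_slice ((hu.contDiffOn_coord 0).differentiableOn (by norm_num)) ht x 1]

lemma IsNSSolution.contDiff_curl (hT : 0 < T) (hu : IsNSSolution σ L T f φ u p)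
    {t : ℝ} (ht : t ∈ Icc 0 T) : ContDiff ℝ 2 (curl (u t)) := by
  rw [hu.curl_eq ht]
  exact contDiff_slice (hu.contDiffOn_slabVorticity hT) ht

lemma IsNSSolution.hasDerivWithinAt_curl (hT : 0 < T) (hu : IsNSSolution σ L T f φ u p)
    {t : ℝ} (ht : t ∈ Icc 0 T) (x : Plane) :
    HasDerivWithinAt (fun s => curl (u s) x) (slabDeriv T (1, 0) (slabVorticity T u) (t, x))
      (Icc 0 T) t := by
  refine (hasDerivWithinAt_slice ((hu.contDiffOn_slabVorticity hT).differentiableOn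
    (by norm_num)) ht x).congr (fun s hs => ?_) ?_ <;> rw [hu.curl_eq ‹_›]

/-- The vorticity equation: the curl of the momentum equation. -/
lemma IsNSSolution.vorticity_equation (hT : 0 < T) (hu : IsNSSolution σ L T f φ u p)
    {t : ℝ} (ht : t ∈ Ico 0 T) (x : Plane) :
    slabDeriv T (1, 0) (slabVorticity T u) (t, x) + σ ^ 2 / 2 * lap (curl (u t)) x
      - advect (u t) (curl (u t)) x + curl (f t) x = 0 := by
  have ht' : t ∈ Icc 0 T := Ico_subset_Icc_self ht
  have hz : (t, x) ∈ slab T := ⟨ht', mem_univ _⟩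
  set U : Fin 2 → ℝ × Plane → ℝ := fun i z => u z.1 z.2 i with hU
  set D : Fin 2 → (ℝ × Plane → ℝ) → ℝ × Plane → ℝ := fun i => slabDeriv T (0, basisVec i) with hD
  have hU3 : ∀ i, ContDiffOn ℝ (3 : ℕ) (U i) (slab T) := fun i => hu.contDiffOn_coord i
  have hD2 : ∀ i v, ContDiffOn ℝ (2 : ℕ) (slabDeriv T v (U i)) (slab T) :=
    fun i v => contDiffOn_slabDeriv hT (hU3 i) le_rfl v
  have hD1 : ∀ i v w, ContDiffOn ℝ (1 : ℕ) (slabDeriv T w (slabDeriv T v (U i))) (slab T) :=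
    fun i v w => contDiffOn_slabDeriv hT (hD2 i v) le_rfl w
  have hUd : ∀ i, DifferentiableOn ℝ (U i) (slab T) :=
    fun i => (hU3 i).differentiableOn (by norm_num)
  have hDd : ∀ i v, DifferentiableOn ℝ (slabDeriv T v (U i)) (slab T) :=
    fun i v => (hD2 i v).differentiableOn (by norm_num)
  have hDDd : ∀ i v w, DifferentiableOn ℝ (slabDeriv T w (slabDeriv T v (U i))) (slab T) :=
    fun i v w => (hD1 i v w).differentiableOn (by norm_num)
  have hpd : ∀ i j, pd j (fun y => u t y i) = fun y => D j (U i) (t, y) :=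
    fun i j => funext fun y => pd_slice (hUd i) ht' y j
  have hpd2 : ∀ i j, pd j (pd j (fun y => u t y i)) = fun y => D j (D j (U i)) (t, y) := by
    intro i j
    rw [hpd]
    exact funext fun y => pd_slice (hDd i _) ht' y j
  -- Solving for `f` turns the curl of the momentum equation into the computation of `curl f` from
  -- derivatives of `u` and `p`.
  have hf : ∀ i, (fun y => f t y i) = fun y => -slabDeriv T (1, 0) (U i) (t, y)
      - σ ^ 2 / 2 * (D 0 (D 0 (U i)) (t, y) + D 1 (D 1 (U i)) (t, y))
      + (U 0 (t, y) * D 0 (U i) (t, y) + U 1 (t, y) * D 1 (U i) (t, y)) + pd i (p t) y := by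
    intro i
    funext y
    have h := hu.momentum t ht y i
    rw [(hasDerivWithinAt_slice (hUd i) ht' y).derivWithin (uniqueDiffOn_Icc hT t ht')] at h
    simp only [lap, advect, Fin.sum_univ_two, hpd2] at h
    simp only [hpd] at h
    simp only [hU] at h ⊢
    linarith
  have sl : ∀ {G : ℝ × Plane → ℝ}, DifferentiableOn ℝ G (slab T) →
      DifferentiableAt ℝ (fun y => G (t, y)) x :=
    fun hG => (hasFDerivAt_slice hG ht' x).differentiableAt
  have hfp : ∀ i j, pd j (fun y => f t y i) x = -D j (slabDeriv T (1, 0) (U i)) (t, x)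
      - σ ^ 2 / 2 * (D j (D 0 (D 0 (U i))) (t, x) + D j (D 1 (D 1 (U i))) (t, x))
      + (D j (U 0) (t, x) * D 0 (U i) (t, x) + U 0 (t, x) * D j (D 0 (U i)) (t, x)
        + (D j (U 1) (t, x) * D 1 (U i) (t, x) + U 1 (t, x) * D j (D 1 (U i)) (t, x)))
      + pd j (pd i (p t)) x := by
    intro i j
    rw [hf i, pd_combination (σ ^ 2 / 2) j x (sl (hDd i _)) (sl (hDDd i _ _)) (sl (hDDd i _ _))
      (sl (hUd 0)) (sl (hDd i _)) (sl (hUd 1)) (sl (hDd i _))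
      ((contDiff_pd (n := 1) (hu.smooth_p t ht') i).differentiable (by norm_num) x)]
    rw [pd_slice (hDd i _) ht', pd_slice (hDDd i _ _) ht', pd_slice (hDDd i _ _) ht',
      pd_slice (hUd 0) ht', pd_slice (hUd 1) ht', pd_slice (hDd i _) ht', pd_slice (hDd i _) ht']
  have hW : ∀ v, EqOn (slabDeriv T v (slabVorticity T u))
      (fun z => slabDeriv T v (D 0 (U 1)) z - slabDeriv T v (D 1 (U 0)) z) (slab T) :=
    fun v z hz => slabDeriv_sub hT (hDd 1 _) (hDd 0 _) hz
  have hW2 : ∀ v w, slabDeriv T w (slabDeriv T v (slabVorticity T u)) (t, x) =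
      slabDeriv T w (slabDeriv T v (D 0 (U 1))) (t, x)
        - slabDeriv T w (slabDeriv T v (D 1 (U 0))) (t, x) := by
    intro v w
    rw [slabDeriv_congr (hW v) hz, slabDeriv_sub hT (hDDd 1 _ _) (hDDd 0 _ _) hz]
  have hWd := (hu.contDiffOn_slabVorticity hT).differentiableOn (by norm_num)
  have hpdW : ∀ j, pd j (curl (u t)) = fun y => D j (slabVorticity T u) (t, y) := by
    intro j
    rw [hu.curl_eq ht']
    exact funext fun y => pd_slice hWd ht' y j
  have hpdW2 : ∀ j, pd j (pd j (curl (u t))) x = D j (D j (slabVorticity T u)) (t, x) := by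
    intro j
    rw [hpdW]
    exact pd_slice ((contDiffOn_slabDeriv hT (m := 1) (n := 2) (hu.contDiffOn_slabVorticity hT)
      le_rfl _).differentiableOn (by norm_num)) ht' x j
  have hdiv : D 0 (U 0) (t, x) + D 1 (U 1) (t, x) = 0 := by
    have h := hu.div_free t ht' x
    simpa only [div, Fin.sum_univ_two, hpd] using h
  have swap2 : ∀ i v w, slabDeriv T v (slabDeriv T w (U i)) (t, x)
      = slabDeriv T w (slabDeriv T v (U i)) (t, x) :=
    fun i v w => slabDeriv_comm hT ((hU3 i).of_le (by norm_num)) hz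
  have swap3 : ∀ i v w, slabDeriv T v (slabDeriv T w (slabDeriv T w (U i))) (t, x)
      = slabDeriv T w (slabDeriv T w (slabDeriv T v (U i))) (t, x) := by
    intro i v w
    rw [slabDeriv_comm hT (hD2 i w) hz]
    -- The second exchange takes place under an outer derivative, so it is needed on the whole slab
    -- and not only at `(t, x)`.
    exact slabDeriv_congr
      (fun y hy => slabDeriv_comm hT ((hU3 i).of_le (by norm_num)) hy) hz
  rw [curl, hfp 1 0, hfp 0 1, lap, advect]
  simp only [Fin.sum_univ_two, hpdW2]
  simp only [hpdW]
  simp only [hD] at *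
  rw [hW2, hW2, hW (1, 0) hz, hW (0, basisVec 0) hz, hW (0, basisVec 1) hz]
  beta_reduce
  rw [
    swap2 1 (0, basisVec 0) (1, 0), swap2 0 (0, basisVec 1) (1, 0),
    swap3 1 (0, basisVec 0) (0, basisVec 1), swap3 0 (0, basisVec 1) (0, basisVec 0),
    swap2 1 (0, basisVec 0) (0, basisVec 1), swap2 0 (0, basisVec 1) (0, basisVec 0),
    pd_pd_comm (hu.smooth_p t ht') 0 1]
  simp only [hU] at *
  -- The curl of `(u, ∇)u` is `(u, ∇)ω + ω div u`; the last term is all that remains.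
  linear_combination (slabDeriv T (0, basisVec 0) (fun z => u z.1 z.2 1) (t, x)
    - slabDeriv T (0, basisVec 1) (fun z => u z.1 z.2 0) (t, x)) * hdiv

end Vorticity

/-! ### Reduction of periodic functions to a compact cell. -/

section Periodicity

variable {L : ℝ}

/-- The closed period cell `[0, L]²`. -/
def closedCell (L : ℝ) : Set Plane := {x | ∀ i, x i ∈ Icc 0 L}

lemma isCompact_closedCell (L : ℝ) : IsCompact (closedCell L) := by
  have h : closedCell L = WithLp.toLp 2 '' (univ.pi fun _ : Fin 2 => Icc (0 : ℝ) L) := by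
    ext x
    refine ⟨fun hx => ⟨x.ofLp, fun i _ => hx i, rfl⟩, ?_⟩
    rintro ⟨y, hy, rfl⟩ i
    exact hy i (mem_univ i)
  rw [h]
  exact (isCompact_univ_pi fun _ => isCompact_Icc).image (PiLp.continuous_toLp 2 _)

lemma IsPeriodic.add_zsmul {α : Type*} {F : Plane → α} (hF : IsPeriodic L F) (i : Fin 2) (n : ℤ)
    (x : Plane) : F (x + n • (L • basisVec i)) = F x :=
  Function.Periodic.zsmul (f := F) (hF i) n x

lemma IsPeriodic.add_lattice {α : Type*} {F : Plane → α} (hF : IsPeriodic L F) (m n : ℤ)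
    (x : Plane) : F (x + m • (L • basisVec 0) + n • (L • basisVec 1)) = F x := by
  rw [hF.add_zsmul, hF.add_zsmul]

/-- Each coordinate is shifted by `⌊x i / L⌋` periods. The cell is taken closed for compactness, so
that bounds and maxima over the plane can be found on it. -/
lemma exists_mem_closedCell (hL : 0 < L) (x : Plane) : ∃ y ∈ closedCell L,
    ∀ (α : Type) (F : Plane → α), IsPeriodic L F → F y = F x := by
  refine ⟨x + (-⌊x 0 / L⌋) • (L • basisVec 0) + (-⌊x 1 / L⌋) • (L • basisVec 1), fun i => ?_,
    fun α F hF => hF.add_lattice _ _ x⟩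
  have h : ∀ r : ℝ, r - ⌊r / L⌋ * L ∈ Icc 0 L := by
    intro r
    have h1 := Int.floor_le (r / L)
    have h2 := Int.lt_floor_add_one (r / L)
    rw [le_div_iff₀ hL] at h1
    rw [div_lt_iff₀ hL] at h2
    constructor <;> nlinarith
  fin_cases i
  · convert! h (x 0) using 1
    simp [basisVec, sub_eq_add_neg]
  · convert! h (x 1) using 1
    simp [basisVec, sub_eq_add_neg]

lemma IsPeriodic.pd {F : Plane → ℝ} (hF : IsPeriodic L F) (i : Fin 2) :
    IsPeriodic L (PeriodicNS.pd i F) := by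
  intro j x
  have h : (fun y => F (y + L • basisVec j)) = F := funext (hF j)
  rw [PeriodicNS.pd, PeriodicNS.pd, ← fderiv_comp_add_right, h]

lemma IsPeriodic.coord {v : Plane → Plane} (hv : IsPeriodic L v) (i : Fin 2) :
    IsPeriodic L (fun x => v x i) := fun j x => by simp only [hv j x]

lemma IsPeriodic.curl {v : Plane → Plane} (hv : IsPeriodic L v) :
    IsPeriodic L (PeriodicNS.curl v) := fun j x => by
  rw [PeriodicNS.curl, PeriodicNS.curl, (hv.coord 1).pd 0 j x, (hv.coord 0).pd 1 j x]

lemma exists_bound_of_periodic (hL : 0 < L) {T : ℝ} {G : ℝ × Plane → ℝ}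
    (hG : ContinuousOn G (slab T)) (hp : ∀ t ∈ Icc 0 T, IsPeriodic L (fun x => G (t, x))) :
    ∃ C, 0 ≤ C ∧ ∀ t ∈ Icc 0 T, ∀ x, |G (t, x)| ≤ C := by
  obtain ⟨C, hC⟩ := (isCompact_Icc.prod (isCompact_closedCell L)).exists_bound_of_continuousOn
    (hG.mono (prod_mono_right (subset_univ _)))
  refine ⟨max C 0, le_max_right _ _, fun t ht x => ?_⟩
  obtain ⟨y, hy, hxy⟩ := exists_mem_closedCell hL x
  rw [← hxy _ _ (hp t ht)]
  exact (hC (t, y) ⟨ht, hy⟩).trans (le_max_left _ _)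

end Periodicity

/-! ### The maximum principle. -/

section Maximum

variable {F : Plane → ℝ} {x : Plane}

lemma hasDerivAt_line (hF : Differentiable ℝ F) (x : Plane) (i : Fin 2) (s : ℝ) :
    HasDerivAt (fun s : ℝ => F (x + s • basisVec i)) (pd i F (x + s • basisVec i)) s := by
  have h1 : HasDerivAt (fun s : ℝ => x + s • basisVec i) (basisVec i) s := by
    simpa using ((hasDerivAt_id s).smul_const (basisVec i)).const_add x
  exact (hF (x + s • basisVec i)).hasFDerivAt.comp_hasDerivAt s h1

lemma pd_eq_zero_of_max (h : ∀ y, F y ≤ F x) (i : Fin 2) : pd i F x = 0 := by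
  have hm : IsLocalMax F x := Filter.Eventually.of_forall h
  rw [pd, hm.fderiv_eq_zero]
  rfl

/-- Were the second derivative positive, the point would also be a local minimum along the line. The
restriction would then be locally constant there, with zero second derivative. -/
lemma pd_pd_nonpos_of_max (hF : ContDiff ℝ 2 F) (h : ∀ y, F y ≤ F x) (i : Fin 2) :
    pd i (pd i F) x ≤ 0 := by
  by_contra! hpos
  set ψ : ℝ → ℝ := fun s => F (x + s • basisVec i) with hψ
  have hd1 : deriv ψ = fun s => pd i F (x + s • basisVec i) :=
    funext fun s => (hasDerivAt_line (hF.differentiable (by norm_num)) x i s).deriv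
  have hd2 : ∀ s, deriv (deriv ψ) s = pd i (pd i F) (x + s • basisVec i) := by
    intro s
    rw [hd1]
    exact (hasDerivAt_line ((contDiff_pd (n := 1) hF i).differentiable (by norm_num)) x i s).deriv
  have hmin : IsLocalMin ψ 0 := by
    apply isLocalMin_of_deriv_deriv_pos
    · simpa [hd2] using hpos
    · simpa [hd1] using pd_eq_zero_of_max h i
    · exact (hasDerivAt_line (hF.differentiable (by norm_num)) x i 0).continuousAt
  have hconst : ψ =ᶠ[nhds 0] fun _ => ψ 0 := by
    filter_upwards [hmin] with s hs
    refine le_antisymm ?_ hs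
    simpa [hψ] using h (x + s • basisVec i)
  have h0 : deriv (deriv ψ) 0 = 0 := by
    rw [hconst.deriv.deriv_eq]
    simp
  rw [hd2] at h0
  simp at h0
  linarith

lemma lap_nonpos_of_max (hF : ContDiff ℝ 2 F) (h : ∀ y, F y ≤ F x) : lap F x ≤ 0 :=
  Finset.sum_nonpos fun i _ => pd_pd_nonpos_of_max hF h i

lemma advect_eq_zero_of_max (v : Plane → Plane) (h : ∀ y, F y ≤ F x) : advect v F x = 0 :=
  Finset.sum_eq_zero fun i _ => by rw [pd_eq_zero_of_max h i, mul_zero]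

/-- As `t < b`, moving forward in time stays in the interval, which fixes the sign even at the left
end `t = a`. -/
lemma hasDerivWithinAt_nonpos_of_max {a b t c : ℝ} {ψ : ℝ → ℝ} (ht : t ∈ Ico a b)
    (hd : HasDerivWithinAt ψ c (Icc a b) t) (hm : ∀ s ∈ Icc a b, ψ s ≤ ψ t) : c ≤ 0 := by
  have hmax : IsLocalMaxOn ψ (Icc a b) t := by
    filter_upwards [self_mem_nhdsWithin] with s hs using hm s hs
  have hseg : segment ℝ t b ⊆ Icc a b := by
    rw [segment_eq_Icc ht.2.le]
    exact Icc_subset_Icc_left ht.1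
  have h := hmax.hasFDerivWithinAt_nonpos hd.hasFDerivWithinAt
    (sub_mem_posTangentConeAt_of_segment_subset hseg)
  simp at h
  nlinarith [ht.2]

/-- The weak maximum principle for the backward linear problem on the torus. -/
lemma le_of_backward_parabolic {L a b M ν : ℝ} (hL : 0 < L) (hν : 0 ≤ ν) {v : Plane → Plane}
    {D D' : ℝ → Plane → ℝ}
    (hc : ContinuousOn (fun z : ℝ × Plane => D z.1 z.2) (Icc a b ×ˢ univ))
    (hs : ∀ t ∈ Ico a b, ContDiff ℝ 2 (D t))
    (hp : ∀ t ∈ Icc a b, IsPeriodic L (D t))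
    (hd : ∀ t ∈ Ico a b, ∀ x, HasDerivWithinAt (fun s => D s x) (D' t x) (Icc a b) t)
    (heq : ∀ t ∈ Ico a b, ∀ x, -M ≤ D' t x - advect v (D t) x + ν * lap (D t) x)
    (hb : ∀ x, D b x ≤ 0) {t : ℝ} (ht : t ∈ Icc a b) (x : Plane) : D t x ≤ M * (b - t) := by
  by_contra! hlt
  have htb : 0 < b - t := by
    rcases ht.2.eq_or_lt with rfl | h
    · have := hb x
      simp at hlt
      linarith
    · linarith
  -- The slope is raised to make the final contradiction strict; this `ε` uses up half of the excess
  -- of `D t x` over `M * (b - t)`.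
  obtain ⟨ε, hε, hεt⟩ : ∃ ε, 0 < ε ∧ 0 < D t x - (M + ε) * (b - t) := by
    refine ⟨(D t x - M * (b - t)) / (2 * (b - t)), div_pos (by linarith) (by linarith), ?_⟩
    rw [add_mul, div_mul_eq_mul_div, mul_div_mul_right _ _ htb.ne']
    linarith
  have hE : ContinuousOn (fun z : ℝ × Plane => D z.1 z.2 - (M + ε) * (b - z.1))
      (Icc a b ×ˢ closedCell L) :=
    (hc.mono (prod_mono_right (subset_univ _))).sub (by fun_prop)
  obtain ⟨y, hy, hxy⟩ := exists_mem_closedCell hL x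
  obtain ⟨⟨t₀, x₀⟩, ⟨ht₀, hx₀⟩, hmax⟩ :=
    (isCompact_Icc.prod (isCompact_closedCell L)).exists_isMaxOn ⟨(t, y), ht, hy⟩ hE
  have hmax' : ∀ s ∈ Icc a b, ∀ z, D s z - (M + ε) * (b - s)
      ≤ D t₀ x₀ - (M + ε) * (b - t₀) := by
    intro s hs' z
    obtain ⟨z', hz', hzz⟩ := exists_mem_closedCell hL z
    have h := hmax (show (s, z') ∈ Icc a b ×ˢ closedCell L from ⟨hs', hz'⟩)
    simp only [mem_ofPred_eq] at h
    rwa [hzz _ _ (hp s hs')] at h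
  have hpos : 0 < D t₀ x₀ - (M + ε) * (b - t₀) := hεt.trans_le (hmax' t ht x)
  -- The maximum is positive, while the compared function is nonpositive at the terminal time.
  have ht₀b : t₀ ∈ Ico a b := by
    refine ⟨ht₀.1, lt_of_le_of_ne ht₀.2 ?_⟩
    intro h
    simp only at ht₀
    rw [h] at hpos
    have := hb x₀
    simp at hpos
    linarith
  have hmx : ∀ z, D t₀ z ≤ D t₀ x₀ := fun z => by linarith [hmax' t₀ ht₀ z]
  have hder : HasDerivWithinAt (fun s => D s x₀ - (M + ε) * (b - s))
      (D' t₀ x₀ - (M + ε) * (-1)) (Icc a b) t₀ :=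
    (hd t₀ ht₀b x₀).sub (((hasDerivAt_id t₀).const_sub b).const_mul (M + ε)).hasDerivWithinAt
  have hD' := hasDerivWithinAt_nonpos_of_max ht₀b hder (fun s hs' => hmax' s hs' x₀)
  have hlap := lap_nonpos_of_max (hs t₀ ht₀b) hmx
  have h := heq t₀ ht₀b x₀
  rw [advect_eq_zero_of_max v hmx] at h
  -- At the maximum the time derivative is at most `-(M + ε)`, advection vanishes and diffusion is
  -- nonpositive, against the lower bound `-M`.
  nlinarith [mul_nonneg hν (neg_nonneg.2 hlap)]

end Maximum

/-! ### Fourier series and Parseval, transported from the unit torus by `x = L y`. -/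

section Torus

open scoped Pointwise

/-- The circle `ℝ / ℤ` carries the Haar measure of total mass one. -/
noncomputable local instance : MeasureSpace UnitAddCircle := ⟨AddCircle.haarAddCircle⟩

local instance : Measure.IsAddHaarMeasure (volume : Measure UnitAddCircle) :=
  inferInstanceAs (Measure.IsAddHaarMeasure AddCircle.haarAddCircle)

local instance : IsProbabilityMeasure (volume : Measure UnitAddCircle) :=
  inferInstanceAs (IsProbabilityMeasure AddCircle.haarAddCircle)

open UnitAddTorus

variable {L : ℝ}

lemma expMode_smul (hL : 0 < L) (n : Fin 2 → ℤ) (y : Fin 2 → ℝ) :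
    expMode L n (L • WithLp.toLp 2 y) = mFourier n (fun i => (y i : UnitAddCircle)) := by
  have hL' : (L : ℂ) ≠ 0 := by exact_mod_cast hL.ne'
  simp only [mFourier, ContinuousMap.coe_mk, fourier_coe_apply, expMode, Fin.prod_univ_two,
    Fin.sum_univ_two, ← Complex.exp_add]
  congr 1
  simp
  field_simp

/-- Continuity of a function on the torus can thus be checked on its lift to the plane. -/
lemma isQuotientMap_torus :
    Topology.IsQuotientMap (fun (y : Fin 2 → ℝ) (i : Fin 2) => (y i : UnitAddCircle)) :=
  (IsOpenQuotientMap.piMap (f := fun (_ : Fin 2) (r : ℝ) => (r : UnitAddCircle))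
    fun _ => QuotientAddGroup.isOpenQuotientMap_mk).isQuotientMap

lemma exists_torus_lift {w : Plane → ℂ} (hw : Continuous w) (hp : IsPeriodic L w) :
    ∃ W : C(UnitAddTorus (Fin 2), ℂ), ∀ y : Fin 2 → ℝ,
      W (fun i => (y i : UnitAddCircle)) = w (L • WithLp.toLp 2 y) := by
  have hy : ∀ y y' : Fin 2 → ℝ, (∀ i, (y i : UnitAddCircle) = y' i) →
      w (L • WithLp.toLp 2 y) = w (L • WithLp.toLp 2 y') := by
    intro y y' h
    have h' : ∀ i, ∃ n : ℤ, y i = y' i + n := by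
      intro i
      obtain ⟨n, hn⟩ := (QuotientAddGroup.eq_iff_sub_mem.1 (h i))
      refine ⟨n, ?_⟩
      simp at hn
      linarith
    choose n hn using h'
    rw [← hp.add_lattice (n 0) (n 1) (L • WithLp.toLp 2 y')]
    congr 1
    ext i
    fin_cases i <;> simp [hn, basisVec] <;> ring
  -- The lift is defined through chosen representatives; `hy` makes the choice immaterial.
  refine ⟨⟨fun t => w (L • WithLp.toLp 2 fun i => Quotient.out (t i)), ?_⟩, ?_⟩
  · rw [isQuotientMap_torus.continuous_iff]
    have : ((fun t : UnitAddTorus (Fin 2) => w (L • WithLp.toLp 2 fun i => Quotient.out (t i))) ∘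
        fun (y : Fin 2 → ℝ) (i : Fin 2) => (y i : UnitAddCircle))
        = fun y => w (L • WithLp.toLp 2 y) := by
      funext y
      exact hy _ _ fun i => Quotient.out_eq _
    rw [this]
    exact hw.comp ((PiLp.continuous_toLp 2 _).const_smul L)
  · intro y
    exact hy _ _ fun i => Quotient.out_eq _

/-- The change of variables `x = L y` has Jacobian `L ^ 2`, and the unit cell is a fundamental
domain of the torus. -/
lemma setIntegral_cell {E : Type*} [NormedAddCommGroup E] [NormedSpace ℝ E] (hL : 0 < L)
    {F : Plane → E} {Φ : UnitAddTorus (Fin 2) → E}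
    (h : ∀ y : Fin 2 → ℝ, Φ (fun i => (y i : UnitAddCircle)) = F (L • WithLp.toLp 2 y)) :
    ∫ x in cell L, F x = L ^ 2 • ∫ t, Φ t := by
  have hcell : cell L = L • (cell 1 : Set Plane) := by
    ext x
    rw [mem_smul_set_iff_inv_smul_mem₀ hL.ne']
    simp only [cell, mem_ofPred_eq, mem_Ioc, PiLp.smul_apply, smul_eq_mul]
    refine forall_congr' fun i => ?_
    rw [inv_mul_le_iff₀ hL, mul_one, mul_pos_iff_of_pos_left (inv_pos.2 hL)]
  have h1 := Measure.setIntegral_comp_smul_of_pos (volume : Measure Plane) F (cell 1) hL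
  rw [← hcell, finrank_euclideanSpace_fin] at h1
  have h2 := (PiLp.volume_preserving_toLp (Fin 2)).setIntegral_preimage_emb
    (MeasurableEquiv.toLp 2 (Fin 2 → ℝ)).measurableEmbedding (fun x => F (L • x)) (cell 1)
  rw [integral_preimage Φ 0]
  simp only [h]
  have h3 : {x : Fin 2 → ℝ | ∀ i, x i ∈ Ioc ((0 : Fin 2 → ℝ) i) ((0 : Fin 2 → ℝ) i + 1)}
      = WithLp.toLp 2 ⁻¹' cell 1 := by
    ext x
    simp [cell]
  rw [h3, h2, h1, smul_smul, mul_inv_cancel₀ (by positivity), one_smul]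

lemma volume_real_cell (hL : 0 < L) : volume.real (cell L) = L ^ 2 := by
  have h := setIntegral_cell hL (F := fun _ => (1 : ℝ)) (Φ := fun _ => 1) (fun _ => rfl)
  simpa using h

lemma integral_sq_toLp (W : C(UnitAddTorus (Fin 2), ℂ)) :
    ∫ t, ‖(W.toLp 2 volume ℂ : Lp ℂ 2 (volume : Measure (UnitAddTorus (Fin 2)))) t‖ ^ 2
      = ∫ t, ‖W t‖ ^ 2 := by
  refine integral_congr_ae ?_
  filter_upwards [ContinuousMap.coeFn_toLp (p := 2) (𝕜 := ℂ) volume W] with t ht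
  rw [ht]

lemma hasSum_sq_mFourierCoeff_continuous (W : C(UnitAddTorus (Fin 2), ℂ)) :
    HasSum (fun n => ‖mFourierCoeff W n‖ ^ 2) (∫ t, ‖W t‖ ^ 2) := by
  have h := hasSum_sq_mFourierCoeff (W.toLp 2 volume ℂ)
  simpa only [mFourierCoeff_toLp, integral_sq_toLp] using h

/-- The series converges uniformly, hence in `L²`, where pairing with an orthonormal mode picks out
one coefficient. -/
lemma mFourierCoeff_tsum {c : (Fin 2 → ℤ) → ℂ} (hc : Summable c) (n : Fin 2 → ℤ) :
    mFourierCoeff (∑' m, c m • mFourier m : C(UnitAddTorus (Fin 2), ℂ)) n = c n := by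
  have hs : Summable fun m => c m • (mFourier m : C(UnitAddTorus (Fin 2), ℂ)) := by
    refine Summable.of_norm ?_
    simpa only [norm_smul, mFourier_norm, mul_one] using hc.norm
  have h1 := (ContinuousMap.toLp (E := ℂ) 2 (volume : Measure (UnitAddTorus (Fin 2))) ℂ).hasSum
    hs.hasSum
  have h2 := (innerSL ℂ (mFourierLp (d := Fin 2) 2 n)).hasSum h1
  have h3 : ∀ m, innerSL ℂ (mFourierLp (d := Fin 2) 2 n)
      (ContinuousMap.toLp (E := ℂ) 2 (volume : Measure (UnitAddTorus (Fin 2))) ℂ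
        (c m • mFourier m)) = if m = n then c n else 0 := by
    intro m
    rw [map_smul, map_smul, innerSL_apply_apply, orthonormal_iff_ite.1 orthonormal_mFourier]
    rcases eq_or_ne m n with rfl | h
    · simp
    · simp [h, h.symm]
  simp only [h3] at h2
  have h4 := h2.unique (hasSum_ite_eq n (c n))
  rw [← h4, ← mFourierCoeff_toLp, ← mFourierBasis_repr, HilbertBasis.repr_apply_apply,
    coe_mFourierBasis, innerSL_apply_apply]

lemma fourierCoef_eq_mFourierCoeff (hL : 0 < L) {w : Plane → ℝ}
    {W : C(UnitAddTorus (Fin 2), ℂ)}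
    (h : ∀ y : Fin 2 → ℝ, W (fun i => (y i : UnitAddCircle)) = (w (L • WithLp.toLp 2 y) : ℂ))
    (n : Fin 2 → ℤ) : fourierCoef L w n = mFourierCoeff W n := by
  have hL' : (L : ℂ) ≠ 0 := by exact_mod_cast hL.ne'
  rw [fourierCoef, setIntegral_cell hL (Φ := fun t => mFourier (-n) t • W t), mFourierCoeff,
    Complex.real_smul]
  · push_cast
    field_simp
  · intro y
    rw [h, expMode_smul hL, smul_eq_mul, mul_comm]

/-- A continuous periodic function with summable Fourier coefficients is the sum of its Fourier
series. -/
lemma hasSum_fourierCoef (hL : 0 < L) {w : Plane → ℝ} (hw : Continuous w)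
    (hp : IsPeriodic L w) (hs : Summable (fourierCoef L w)) (x : Plane) :
    HasSum (fun n => fourierCoef L w n * expMode L n x) (w x : ℂ) := by
  obtain ⟨W, hW⟩ := exists_torus_lift (L := L) (w := fun x => (w x : ℂ)) (by fun_prop)
    (fun i x => congrArg Complex.ofReal (hp i x))
  have hc : mFourierCoeff W = fourierCoef L w :=
    funext fun n => (fourierCoef_eq_mFourierCoeff hL hW n).symm
  have h := hasSum_mFourier_series_apply_of_summable (f := W) (by rwa [hc])
    (fun i => (((L⁻¹ • x) i : ℝ) : UnitAddCircle))
  have hx : L • WithLp.toLp 2 (fun i => (L⁻¹ • x) i) = x := by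
    ext i
    simp [mul_inv_cancel_left₀ hL.ne']
  rw [hW] at h
  simp only [hc, ← expMode_smul hL, hx, smul_eq_mul] at h
  exact h

/-- Parseval's identity for continuous periodic functions. -/
lemma hasSum_sq_fourierCoef (hL : 0 < L) {w : Plane → ℝ} (hw : Continuous w)
    (hp : IsPeriodic L w) :
    HasSum (fun n => ‖fourierCoef L w n‖ ^ 2) ((L ^ 2)⁻¹ * ∫ x in cell L, w x ^ 2) := by
  obtain ⟨W, hW⟩ := exists_torus_lift (L := L) (w := fun x => (w x : ℂ)) (by fun_prop)
    (fun i x => congrArg Complex.ofReal (hp i x))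
  have h := hasSum_sq_mFourierCoeff_continuous W
  rw [setIntegral_cell hL (Φ := fun t => ‖W t‖ ^ 2) (fun y => by simp [hW]), smul_eq_mul,
    inv_mul_cancel_left₀ (by positivity)]
  simpa only [fourierCoef_eq_mFourierCoeff hL hW] using h

/-- Parseval's identity for absolutely convergent trigonometric series. -/
lemma setIntegral_sq_of_hasSum (hL : 0 < L) {c : (Fin 2 → ℤ) → ℂ} (hc : Summable c)
    {G : Plane → ℂ} (hG : ∀ x, HasSum (fun n => c n * expMode L n x) (G x)) :
    Continuous G ∧ ∫ x in cell L, ‖G x‖ ^ 2 = L ^ 2 * ∑' n, ‖c n‖ ^ 2 := by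
  set W : C(UnitAddTorus (Fin 2), ℂ) := ∑' m, c m • mFourier m with hWdef
  have hs : Summable fun m => c m • (mFourier m : C(UnitAddTorus (Fin 2), ℂ)) := by
    refine Summable.of_norm ?_
    simpa only [norm_smul, mFourier_norm, mul_one] using hc.norm
  have hW : ∀ y : Fin 2 → ℝ, W (fun i => (y i : UnitAddCircle)) = G (L • WithLp.toLp 2 y) := by
    intro y
    have h := (ContinuousMap.evalCLM ℂ (fun i => (y i : UnitAddCircle))).hasSum hs.hasSum
    refine h.unique ?_
    simpa [Function.comp_def, expMode_smul hL] using hG (L • WithLp.toLp 2 y)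
  refine ⟨?_, ?_⟩
  · have hGW : G = fun x => W (fun i => (((L⁻¹ • x) i : ℝ) : UnitAddCircle)) := by
      funext x
      rw [hW]
      congr 1
      ext i
      simp [mul_inv_cancel_left₀ hL.ne']
    rw [hGW]
    refine W.continuous.comp (continuous_pi fun i => ?_)
    exact (AddCircle.continuous_mk' 1).comp (by fun_prop)
  · rw [setIntegral_cell hL (Φ := fun t => ‖W t‖ ^ 2) (fun y => by simp [hW]), smul_eq_mul,
      ← (hasSum_sq_mFourierCoeff_continuous W).tsum_eq]
    simp only [hWdef, mFourierCoeff_tsum hc]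

end Torus

variable {L : ℝ}

/-! ### Integrals of derivatives over a period cell. -/

section IntegrationByParts

/-- The point of the plane with given coordinates, as a linear map. -/
noncomputable def planePoint : ℝ × ℝ →L[ℝ] Plane :=
  (ContinuousLinearMap.fst ℝ ℝ ℝ).smulRight (basisVec 0)
    + (ContinuousLinearMap.snd ℝ ℝ ℝ).smulRight (basisVec 1)

lemma planePoint_apply (z : ℝ × ℝ) : planePoint z = z.1 • basisVec 0 + z.2 • basisVec 1 := rfl

lemma planePoint_coord (z : ℝ × ℝ) : planePoint z 0 = z.1 ∧ planePoint z 1 = z.2 := by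
  simp [planePoint_apply, basisVec]

lemma measurePreserving_planePoint : MeasurePreserving (planePoint : ℝ × ℝ → Plane) := by
  have h := (PiLp.volume_preserving_toLp (Fin 2)).comp (volume_preserving_finTwoArrow ℝ).symm
  convert! h using 1
  funext z
  ext i
  fin_cases i
  · simpa using (planePoint_coord z).1
  · simpa using (planePoint_coord z).2

lemma cell_subset_closedCell (L : ℝ) : cell L ⊆ closedCell L :=
  fun _ hx i => Ioc_subset_Icc_self (hx i)

lemma volume_cell_lt_top (L : ℝ) : volume (cell L) < ∞ :=
  (measure_mono (cell_subset_closedCell L)).trans_lt (isCompact_closedCell L).measure_lt_top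

instance (L : ℝ) : IsFiniteMeasure (volume.restrict (cell L)) :=
  ⟨by simpa using volume_cell_lt_top L⟩

lemma integrableOn_cell {E : Type*} [NormedAddCommGroup E] {F : Plane → E} (hF : Continuous F) :
    IntegrableOn F (cell L) :=
  (hF.continuousOn.integrableOn_compact (isCompact_closedCell L)).mono_set
    (cell_subset_closedCell L)

lemma setIntegral_cell_eq_iterated (hL : 0 < L) {F : Plane → ℂ} (hF : Continuous F) :
    ∫ x in cell L, F x = ∫ s in 0..L, ∫ t in 0..L, F (planePoint (s, t)) := by
  have hpre : planePoint ⁻¹' cell L = Ioc 0 L ×ˢ Ioc 0 L := by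
    ext z
    simp [cell, Fin.forall_fin_two, planePoint_coord z]
  have hemb : MeasurableEmbedding (planePoint : ℝ × ℝ → Plane) := by
    have h := (MeasurableEquiv.toLp 2 (Fin 2 → ℝ)).measurableEmbedding.comp
      (MeasurableEquiv.finTwoArrow (α := ℝ)).symm.measurableEmbedding
    convert! h using 1
    funext z
    ext i
    fin_cases i
    · simpa using (planePoint_coord z).1
    · simpa using (planePoint_coord z).2
  rw [← measurePreserving_planePoint.setIntegral_preimage_emb hemb, hpre,
    Measure.volume_eq_prod, setIntegral_prod]
  · simp only [intervalIntegral.integral_of_le hL.le]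
  · exact ((hF.comp planePoint.continuous).continuousOn.integrableOn_compact
      (isCompact_Icc.prod isCompact_Icc)).mono_set
      (prod_mono Ioc_subset_Icc_self Ioc_subset_Icc_self)

/-- The integral over a period cell of a derivative of a periodic function vanishes. -/
lemma setIntegral_cell_fderiv (hL : 0 < L) {F : Plane → ℂ} (hF : ContDiff ℝ 1 F)
    (hp : IsPeriodic L F) (i : Fin 2) : ∫ x in cell L, fderiv ℝ F x (basisVec i) = 0 := by
  have hc : Continuous fun x => fderiv ℝ F x (basisVec i) :=
    (hF.continuous_fderiv (by norm_num)).clm_apply continuous_const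
  have hd : ∀ z, HasFDerivAt (fun z => F (planePoint z))
      ((fderiv ℝ F (planePoint z)).comp planePoint) z := fun z =>
    ((hF.differentiable (by norm_num)) _).hasFDerivAt.comp z planePoint.hasFDerivAt
  have hFc : Continuous fun z => F (planePoint z) := hF.continuous.comp planePoint.continuous
  have h0 : ∀ z : ℝ × ℝ, HasFDerivAt (fun _ : ℝ × ℝ => (0 : ℂ)) (0 : ℝ × ℝ →L[ℝ] ℂ) z :=
    fun z => hasFDerivAt_const _ _
  have hi : Continuous fun z : ℝ × ℝ => fderiv ℝ F (planePoint z) (basisVec i) :=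
    hc.comp planePoint.continuous
  rw [setIntegral_cell_eq_iterated hL hc]
  -- The divergence theorem on the square is applied to `(F, 0)` or `(0, F)`; the contributions of
  -- opposite edges cancel by periodicity.
  fin_cases i
  · have h := integral2_divergence_prod_of_hasFDerivAt (fun z => F (planePoint z)) (fun _ => 0)
      (fun z => (fderiv ℝ F (planePoint z)).comp planePoint) (fun _ => 0) 0 0 L L
      hFc.continuousOn continuousOn_const (fun z _ => hd z) (fun z _ => h0 z)
      (by
        simpa [planePoint_apply] using
          hi.continuousOn.integrableOn_compact (isCompact_uIcc.prod isCompact_uIcc))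
    simp only [ContinuousLinearMap.coe_comp, Function.comp_apply, planePoint_apply, one_smul,
      zero_smul, add_zero, zero_apply, intervalIntegral.integral_zero] at h
    simp only [Fin.zero_eta, planePoint_apply]
    rw [h]
    have : ∀ y : ℝ, F (L • basisVec 0 + y • basisVec 1) = F (y • basisVec 1) := fun y => by
      rw [add_comm, hp]
    simp [this]
  · have h := integral2_divergence_prod_of_hasFDerivAt (fun _ => 0) (fun z => F (planePoint z))
      (fun _ => 0) (fun z => (fderiv ℝ F (planePoint z)).comp planePoint) 0 0 L L
      continuousOn_const hFc.continuousOn (fun z _ => h0 z) (fun z _ => hd z)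
      (by
        simpa [planePoint_apply] using
          hi.continuousOn.integrableOn_compact (isCompact_uIcc.prod isCompact_uIcc))
    simp only [ContinuousLinearMap.coe_comp, Function.comp_apply, planePoint_apply, one_smul,
      zero_smul, zero_add, add_zero, zero_apply,
      intervalIntegral.integral_zero, hp 1, sub_self] at h
    simpa only [Fin.mk_one, planePoint_apply] using h

end IntegrationByParts

/-! ### Fourier coefficients of derivatives, and their decay. -/

section FourierCoefficients

lemma hasFDerivAt_expMode (L : ℝ) (n : Fin 2 → ℤ) (x : Plane) :
    HasFDerivAt (expMode L n) (expMode L n x • (Complex.I • Complex.ofRealCLM.comp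
      ((2 * Real.pi / L) • ∑ j, (n j : ℝ) • (EuclideanSpace.proj j : Plane →L[ℝ] ℝ)))) x := by
  have h1 : HasFDerivAt (fun x : Plane => 2 * Real.pi / L * ∑ j, (n j : ℝ) * x j)
      ((2 * Real.pi / L) • ∑ j, (n j : ℝ) • (EuclideanSpace.proj j : Plane →L[ℝ] ℝ)) x := by
    have h := ((2 * Real.pi / L) • ∑ j, (n j : ℝ) •
      (EuclideanSpace.proj j : Plane →L[ℝ] ℝ)).hasFDerivAt (x := x)
    convert! h using 1
  exact ((Complex.ofRealCLM.hasFDerivAt.comp x h1).const_mul Complex.I).cexp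

lemma contDiff_expMode (L : ℝ) (n : Fin 2 → ℤ) : ContDiff ℝ 1 (expMode L n) := by
  have h : ContDiff ℝ 1 fun x : Plane =>
      Complex.I * Complex.ofRealCLM (2 * Real.pi / L * ∑ j, (n j : ℝ) * x j) := by
    fun_prop
  exact h.cexp

lemma continuous_expMode (L : ℝ) (n : Fin 2 → ℤ) : Continuous (expMode L n) :=
  (contDiff_expMode L n).continuous

lemma norm_expMode (L : ℝ) (n : Fin 2 → ℤ) (x : Plane) : ‖expMode L n x‖ = 1 := by
  rw [expMode, mul_comm, Complex.norm_exp_ofReal_mul_I]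

lemma conj_expMode (L : ℝ) (n : Fin 2 → ℤ) (x : Plane) :
    (starRingEnd ℂ) (expMode L n x) = expMode L (-n) x := by
  rw [expMode, expMode, ← Complex.exp_conj, map_mul, Complex.conj_I, Complex.conj_ofReal]
  congr 1
  simp
  ring

lemma isPeriodic_expMode (hL : 0 < L) (n : Fin 2 → ℤ) : IsPeriodic L (expMode L n) := by
  intro i x
  have hL' : (L : ℂ) ≠ 0 := by exact_mod_cast hL.ne'
  rw [expMode, expMode, Complex.exp_eq_exp_iff_exists_int]
  refine ⟨n i, ?_⟩
  fin_cases i <;> simp [basisVec] <;> field_simp <;> ring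

/-- Integration by parts for Fourier coefficients. -/
lemma fourierCoef_pd (hL : 0 < L) {w : Plane → ℝ} (hw : ContDiff ℝ 1 w) (hp : IsPeriodic L w)
    (i : Fin 2) (n : Fin 2 → ℤ) :
    fourierCoef L (pd i w) n = 2 * Real.pi * Complex.I * n i / L * fourierCoef L w n := by
  have hd : ∀ x, fderiv ℝ (fun x => (w x : ℂ) * expMode L (-n) x) x (basisVec i)
      = (pd i w x : ℂ) * expMode L (-n) x
        - 2 * Real.pi * Complex.I * n i / L * ((w x : ℂ) * expMode L (-n) x) := by
    intro x
    have h := (Complex.ofRealCLM.hasFDerivAt.comp x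
      ((hw.differentiable (by norm_num)) x).hasFDerivAt).mul (hasFDerivAt_expMode L (-n) x)
    have h' : HasFDerivAt (fun x => (w x : ℂ) * expMode L (-n) x) _ x := h
    rw [h'.fderiv]
    fin_cases i <;> simp [basisVec, pd] <;> ring
  have hz := setIntegral_cell_fderiv hL (F := fun x => (w x : ℂ) * expMode L (-n) x)
    ((Complex.ofRealCLM.contDiff.comp hw).mul (contDiff_expMode L (-n)))
    (fun j x => by simp only [hp j x, isPeriodic_expMode hL (-n) j x]) i
  have hc1 : Continuous fun x => (pd i w x : ℂ) * expMode L (-n) x :=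
    (Complex.continuous_ofReal.comp (contDiff_pd (n := 0) (by simpa using hw) i).continuous).mul
      (continuous_expMode L _)
  have hc2 : Continuous fun x => (w x : ℂ) * expMode L (-n) x :=
    (Complex.continuous_ofReal.comp hw.continuous).mul (continuous_expMode L _)
  simp only [hd] at hz
  rw [integral_sub (integrableOn_cell hc1) ((integrableOn_cell hc2).const_mul _),
    integral_const_mul, sub_eq_zero] at hz
  rw [fourierCoef, hz, fourierCoef]
  ring

lemma fourierCoef_sub {w₁ w₂ : Plane → ℝ} (h₁ : Continuous w₁) (h₂ : Continuous w₂)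
    (n : Fin 2 → ℤ) : fourierCoef L (fun x => w₁ x - w₂ x) n
      = fourierCoef L w₁ n - fourierCoef L w₂ n := by
  rw [fourierCoef, fourierCoef, fourierCoef, ← mul_sub, ← integral_sub]
  · simp only [Complex.ofReal_sub, sub_mul]
  all_goals exact integrableOn_cell ((Complex.continuous_ofReal.comp ‹_›).mul
    (continuous_expMode L _))

lemma fourierCoef_neg (w : Plane → ℝ) (n : Fin 2 → ℤ) :
    fourierCoef L w (-n) = (starRingEnd ℂ) (fourierCoef L w n) := by
  rw [fourierCoef, fourierCoef, map_mul, ← integral_conj]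
  simp [conj_expMode]

lemma norm_fourierCoef_le (w : Plane → ℝ) (n : Fin 2 → ℤ) :
    ‖fourierCoef L w n‖ ≤ (L ^ 2)⁻¹ * ∫ x in cell L, |w x| := by
  rw [fourierCoef, norm_mul]
  refine mul_le_mul (by simp) ((norm_integral_le_integral_norm _).trans_eq ?_) (norm_nonneg _)
    (by positivity)
  simp [norm_expMode]

/-- The Fourier coefficients of a periodic `C²` function decay quadratically. -/
lemma exists_fourierCoef_decay (hL : 0 < L) {w : Plane → ℝ} (hw : ContDiff ℝ 2 w)
    (hp : IsPeriodic L w) :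
    ∃ C, 0 ≤ C ∧ ∀ n, ((n 0 : ℝ) ^ 2 + (n 1 : ℝ) ^ 2) * ‖fourierCoef L w n‖ ≤ C := by
  have h : ∀ i, ∃ C, 0 ≤ C ∧ ∀ n : Fin 2 → ℤ, (n i : ℝ) ^ 2 * ‖fourierCoef L w n‖ ≤ C := by
    intro i
    -- Two integrations by parts multiply the coefficient by `-(2π nⁱ / L)²`; the factor `(L / 2π)²`
    -- undoes this.
    refine ⟨(L / (2 * Real.pi)) ^ 2 * ((L ^ 2)⁻¹ * ∫ x in cell L, |pd i (pd i w) x|),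
      by positivity, fun n => ?_⟩
    have h1 := norm_fourierCoef_le (L := L) (pd i (pd i w)) n
    rw [fourierCoef_pd hL (contDiff_pd (n := 1) hw i) (hp.pd i),
      fourierCoef_pd hL (hw.of_le (by norm_num)) hp] at h1
    refine le_trans (le_of_eq ?_) (mul_le_mul_of_nonneg_left h1 (by positivity))
    have hpi := Real.pi_pos
    simp [abs_of_pos hL, abs_of_pos hpi]
    field_simp
    rw [sq_abs, mul_comm]
  obtain ⟨C₀, h₀, hC₀⟩ := h 0
  obtain ⟨C₁, h₁, hC₁⟩ := h 1
  exact ⟨C₀ + C₁, by positivity, fun n => by rw [add_mul]; exact add_le_add (hC₀ n) (hC₁ n)⟩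

end FourierCoefficients

/-! ### The Biot–Savart operator. -/

section BiotSavart

variable {L : ℝ} {w : Plane → ℝ}

/-- The Fourier coefficients of the velocity field given by the Biot–Savart operator. -/
noncomputable def biotSavartCoef (L : ℝ) (w : Plane → ℝ) (i : Fin 2) (n : Fin 2 → ℤ) : ℂ :=
  (L * Complex.I / (2 * Real.pi)) * (1 / ((n 0 : ℂ) ^ 2 + (n 1 : ℂ) ^ 2)) *
    fourierCoef L w n * (![(n 1 : ℂ), -(n 0 : ℂ)] i)

lemma biotSavartTerm_eq (L : ℝ) (w : Plane → ℝ) (x : Plane) (n : Fin 2 → ℤ) (i : Fin 2) :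
    biotSavartTerm L w x n i = biotSavartCoef L w i n * expMode L n x := by
  rw [biotSavartTerm, biotSavartCoef]
  ring

lemma norm_biotSavartCoef (hL : 0 < L) (w : Plane → ℝ) (i : Fin 2) (n : Fin 2 → ℤ) :
    ‖biotSavartCoef L w i n‖ = L / (2 * Real.pi) * ‖fourierCoef L w n‖ *
      (|(![n 1, n 0] i : ℝ)| / ((n 0 : ℝ) ^ 2 + (n 1 : ℝ) ^ 2)) := by
  have h : ‖(n 0 : ℂ) ^ 2 + (n 1 : ℂ) ^ 2‖ = (n 0 : ℝ) ^ 2 + (n 1 : ℝ) ^ 2 := by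
    have : (n 0 : ℂ) ^ 2 + (n 1 : ℂ) ^ 2 = (((n 0 : ℝ) ^ 2 + (n 1 : ℝ) ^ 2 : ℝ) : ℂ) := by
      push_cast; rfl
    rw [this, Complex.norm_of_nonneg (by positivity)]
  simp only [biotSavartCoef, norm_mul, norm_div, norm_one, h]
  fin_cases i <;> simp [abs_of_pos hL, abs_of_pos Real.pi_pos] <;> ring

/-- Integers satisfy `|m| ≤ m ^ 2`, so the multiplier is at most `L / 2π`; at `n = 0` the quotient
is `0 / 0 = 0`. -/
lemma norm_biotSavartCoef_le (hL : 0 < L) (w : Plane → ℝ) (i : Fin 2) (n : Fin 2 → ℤ) :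
    ‖biotSavartCoef L w i n‖ ≤ L / (2 * Real.pi) * ‖fourierCoef L w n‖ := by
  rw [norm_biotSavartCoef hL]
  refine mul_le_of_le_one_right (by have := Real.pi_pos; positivity)
    (div_le_one_of_le₀ ?_ (by positivity))
  have h : ∀ m : ℤ, |(m : ℝ)| ≤ (m : ℝ) ^ 2 := fun m => by
    have h := Int.natAbs_le_self_sq m
    rw [Int.natCast_natAbs] at h
    exact_mod_cast h
  have h0 := h (n 0)
  have h1 := h (n 1)
  fin_cases i <;> simp <;> nlinarith [sq_nonneg (n 0 : ℝ), sq_nonneg (n 1 : ℝ)]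

/-- Coefficients of order `|n|⁻²` and the gain `|n|⁻¹` of the kernel give `|n|⁻³`, which is summable
over `ℤ²`. Here `‖n‖` is the sup norm, which the Euclidean norm dominates. -/
lemma summable_biotSavartCoef (hL : 0 < L) (hw : ContDiff ℝ 2 w) (hp : IsPeriodic L w)
    (i : Fin 2) : Summable (biotSavartCoef L w i) := by
  obtain ⟨C, hC, hdec⟩ := exists_fourierCoef_decay hL hw hp
  have hpi := Real.pi_pos
  refine Summable.of_norm_bounded ((EisensteinSeries.summable_one_div_norm_rpow
    (k := 3) (by norm_num)).mul_left (L / (2 * Real.pi) * C)) fun n => ?_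
  rw [norm_biotSavartCoef hL]
  rcases eq_or_ne n 0 with rfl | hn
  · have : (![(0 : Fin 2 → ℤ) 1, (0 : Fin 2 → ℤ) 0] i) = 0 := by
      fin_cases i <;> simp
    rw [this, Int.cast_zero, abs_zero, zero_div, mul_zero]
    positivity
  have hN : 0 < ‖n‖ := norm_pos_iff.2 hn
  have hn0 : |(n 0 : ℝ)| ≤ ‖n‖ := by simpa [Int.norm_eq_abs] using norm_le_pi_norm n 0
  have hn1 : |(n 1 : ℝ)| ≤ ‖n‖ := by simpa [Int.norm_eq_abs] using norm_le_pi_norm n 1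
  have hm : |(![n 1, n 0] i : ℝ)| ≤ ‖n‖ := by
    fin_cases i <;> simpa
  have hq : ‖n‖ ^ 2 ≤ (n 0 : ℝ) ^ 2 + (n 1 : ℝ) ^ 2 := by
    have h : ‖n‖ ≤ √((n 0 : ℝ) ^ 2 + (n 1 : ℝ) ^ 2) := by
      refine (pi_norm_le_iff_of_nonneg (Real.sqrt_nonneg _)).2 fun j => ?_
      rw [Int.norm_eq_abs]
      apply Real.abs_le_sqrt
      fin_cases j
      · exact le_add_of_nonneg_right (sq_nonneg _)
      · exact le_add_of_nonneg_left (sq_nonneg _)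
    calc ‖n‖ ^ 2 ≤ √((n 0 : ℝ) ^ 2 + (n 1 : ℝ) ^ 2) ^ 2 := by gcongr
      _ = _ := Real.sq_sqrt (by positivity)
  have hwn : ‖fourierCoef L w n‖ ≤ C / ‖n‖ ^ 2 := by
    rw [le_div_iff₀ (by positivity), mul_comm]
    exact (mul_le_mul_of_nonneg_right hq (norm_nonneg _)).trans (hdec n)
  have hr : ‖n‖ ^ (-3 : ℝ) = 1 / ‖n‖ ^ 3 := by
    rw [Real.rpow_neg hN.le, one_div]
    norm_cast
  calc L / (2 * Real.pi) * ‖fourierCoef L w n‖ *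
        (|(![n 1, n 0] i : ℝ)| / ((n 0 : ℝ) ^ 2 + (n 1 : ℝ) ^ 2))
      ≤ L / (2 * Real.pi) * (C / ‖n‖ ^ 2) * (‖n‖ / ‖n‖ ^ 2) := by gcongr
    _ = L / (2 * Real.pi) * C * ‖n‖ ^ (-3 : ℝ) := by
      rw [hr]
      field_simp

lemma summable_biotSavartTerm (hL : 0 < L) (hw : ContDiff ℝ 2 w) (hp : IsPeriodic L w)
    (x : Plane) (i : Fin 2) : Summable fun n => biotSavartTerm L w x n i := by
  refine Summable.of_norm ?_
  simp only [biotSavartTerm_eq, norm_mul, norm_expMode, mul_one]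
  exact (summable_biotSavartCoef hL hw hp i).norm

lemma biotSavartTerm_neg (L : ℝ) (w : Plane → ℝ) (x : Plane) (n : Fin 2 → ℤ) (i : Fin 2) :
    biotSavartTerm L w x (-n) i = (starRingEnd ℂ) (biotSavartTerm L w x n i) := by
  rw [biotSavartTerm, biotSavartTerm, fourierCoef_neg, ← conj_expMode]
  have h2 : (starRingEnd ℂ) 2 = 2 := Complex.conj_ofNat 2
  fin_cases i <;> simp [neg_div, h2]

lemma biotSavart_apply (L : ℝ) (w : Plane → ℝ) (x : Plane) (i : Fin 2) :
    biotSavart L w x i = (∑' n, biotSavartTerm L w x n i).re := by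
  fin_cases i <;> simp [biotSavart]

/-- The Biot–Savart series of a periodic `C²` function converges, with real sum. -/
lemma hasSum_biotSavartTerm (hL : 0 < L) (hw : ContDiff ℝ 2 w) (hp : IsPeriodic L w)
    (x : Plane) (i : Fin 2) :
    HasSum (fun n => biotSavartTerm L w x n i) ((biotSavart L w x i : ℝ) : ℂ) := by
  have hs := (summable_biotSavartTerm hL hw hp x i).hasSum
  -- Conjugation reindexes the series by `n ↦ -n`, so its sum is real.
  have h : (starRingEnd ℂ) (∑' n, biotSavartTerm L w x n i) = ∑' n, biotSavartTerm L w x n i := by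
    rw [Complex.conj_tsum, ← (Equiv.neg (Fin 2 → ℤ)).tsum_eq]
    simp [biotSavartTerm_neg]
  rw [biotSavart_apply, Complex.conj_eq_iff_re.1 h]
  exact hs

lemma biotSavart_sub (hL : 0 < L) {w₁ w₂ : Plane → ℝ} (h₁ : ContDiff ℝ 2 w₁)
    (h₂ : ContDiff ℝ 2 w₂) (hp₁ : IsPeriodic L w₁) (hp₂ : IsPeriodic L w₂) (x : Plane) :
    biotSavart L (fun y => w₁ y - w₂ y) x = biotSavart L w₁ x - biotSavart L w₂ x := by
  ext i
  have h := ((hasSum_biotSavartTerm hL h₁ hp₁ x i).sub (hasSum_biotSavartTerm hL h₂ hp₂ x i))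
  have h' : ∀ n, biotSavartTerm L w₁ x n i - biotSavartTerm L w₂ x n i
      = biotSavartTerm L (fun y => w₁ y - w₂ y) x n i := fun n => by
    simp only [biotSavartTerm, fourierCoef_sub h₁.continuous h₂.continuous]
    ring
  simp only [h'] at h
  rw [biotSavart_apply, h.tsum_eq]
  simp

/-- The Biot–Savart operator recovers a divergence-free periodic field of zero mean from its
curl. -/
lemma biotSavart_curl (hL : 0 < L) {v : Plane → Plane} (hv : ∀ i, ContDiff ℝ 1 (fun x => v x i))
    (hc : ContDiff ℝ 2 (curl v)) (hp : IsPeriodic L v) (hdiv : ∀ x, div v x = 0)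
    (hmean : ∀ i, ∫ x in cell L, v x i = 0) (x : Plane) : biotSavart L (curl v) x = v x := by
  have hpi : (Real.pi : ℂ) ≠ 0 := by exact_mod_cast Real.pi_ne_zero
  have hL' : (L : ℂ) ≠ 0 := by exact_mod_cast hL.ne'
  have hpdc : ∀ i j, Continuous (pd j (fun x => v x i)) :=
    fun i j => (contDiff_pd (n := 0) (by simpa using hv i) j).continuous
  have hcurl : ∀ n, fourierCoef L (curl v) n = 2 * Real.pi * Complex.I / L *
      (n 0 * fourierCoef L (fun x => v x 1) n - n 1 * fourierCoef L (fun x => v x 0) n) := by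
    intro n
    have h := fourierCoef_sub (L := L) (hpdc 1 0) (hpdc 0 1) n
    rw [fourierCoef_pd hL (hv 1) (hp.coord 1), fourierCoef_pd hL (hv 0) (hp.coord 0)] at h
    exact h.trans (by ring)
  have hdivc : ∀ n : Fin 2 → ℤ, (n 0 : ℂ) * fourierCoef L (fun x => v x 0) n
      + n 1 * fourierCoef L (fun x => v x 1) n = 0 := by
    intro n
    -- The divergence is written as a difference so that `fourierCoef_sub` applies.
    have h := fourierCoef_sub (L := L) (hpdc 0 0)
      (w₂ := fun x => -pd 1 (fun x => v x 1) x) (hpdc 1 1).neg n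
    have hn : fourierCoef L (fun x => -pd 1 (fun x => v x 1) x) n
        = -fourierCoef L (pd 1 (fun x => v x 1)) n := by
      simp [fourierCoef, integral_neg]
    have hz : ∀ x, pd 0 (fun x => v x 0) x - -pd 1 (fun x => v x 1) x = 0 := fun x => by
      simpa [div, Fin.sum_univ_two] using hdiv x
    simp only [hn, hz] at h
    rw [fourierCoef_pd hL (hv 1) (hp.coord 1), fourierCoef_pd hL (hv 0) (hp.coord 0)] at h
    have h0 : fourierCoef L (fun _ => 0) n = 0 := by simp [fourierCoef]
    rw [h0] at h
    have hk : (2 * Real.pi * Complex.I / L : ℂ) ≠ 0 :=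
      div_ne_zero (mul_ne_zero (mul_ne_zero two_ne_zero hpi) Complex.I_ne_zero) hL'
    refine (mul_eq_zero.1 ?_).resolve_left hk
    rw [h]
    ring
  have hzero : ∀ i, fourierCoef L (fun x => v x i) 0 = 0 := by
    intro i
    have h := congrArg Complex.ofReal (hmean i)
    rw [← integral_complex_ofReal] at h
    simp only [Complex.ofReal_zero] at h
    simp [fourierCoef, expMode, h]
  -- For `n ≠ 0` the relation `(n, vₙ) = 0` turns the numerator into `|n|² vₙ`; at `n = 0` both
  -- sides vanish, by the zero mean.
  have hcoef : ∀ i n, biotSavartCoef L (curl v) i n = fourierCoef L (fun x => v x i) n := by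
    intro i n
    rcases eq_or_ne n 0 with rfl | hn
    · rw [hzero]
      fin_cases i <;> simp [biotSavartCoef]
    have hq : ((n 0 : ℂ) ^ 2 + (n 1 : ℂ) ^ 2) ≠ 0 := by
      have : (n 0) ^ 2 + (n 1) ^ 2 ≠ 0 := by
        intro h
        apply hn
        have h0 : n 0 = 0 := by nlinarith [sq_nonneg (n 0), sq_nonneg (n 1)]
        have h1 : n 1 = 0 := by nlinarith [sq_nonneg (n 0), sq_nonneg (n 1)]
        ext j
        fin_cases j <;> simp [h0, h1]
      exact_mod_cast this
    have hd := hdivc n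
    rw [biotSavartCoef, hcurl]
    field_simp
    rw [Complex.I_sq]
    fin_cases i
    · simp
      linear_combination (-(n 0 : ℂ)) * hd
    · simp
      linear_combination (-(n 1 : ℂ)) * hd
  have hpc : IsPeriodic L (curl v) := hp.curl
  ext i
  -- Being only `C¹`, `v` gets summable coefficients from those of `U` applied to its `C²` curl.
  have hs : Summable (fourierCoef L (fun x => v x i)) := by
    have h := summable_biotSavartCoef hL hc hpc i
    rwa [funext (hcoef i)] at h
  have h1 := hasSum_fourierCoef hL (hv i).continuous (hp.coord i) hs x
  have h2 := hasSum_biotSavartTerm hL hc hpc x i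
  simp only [biotSavartTerm_eq, hcoef] at h2
  exact_mod_cast h2.unique h1

/-- The Biot–Savart operator is bounded from `L^∞` to `L²` of the period cell. -/
lemma memLp_biotSavart (hL : 0 < L) (hw : ContDiff ℝ 2 w) (hp : IsPeriodic L w) {M : ℝ}
    (hM : 0 ≤ M) (hb : ∀ x, |w x| ≤ M) :
    MemLp (biotSavart L w) 2 (volume.restrict (cell L)) ∧
      eLpNorm (biotSavart L w) 2 (volume.restrict (cell L)) ≤ ENNReal.ofReal (L ^ 2 * M) := by
  have hpi := Real.pi_gt_three
  have hi : ∀ i, Continuous (fun x => ((biotSavart L w x i : ℝ) : ℂ)) ∧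
      ∫ x in cell L, ‖((biotSavart L w x i : ℝ) : ℂ)‖ ^ 2
        = L ^ 2 * ∑' n, ‖biotSavartCoef L w i n‖ ^ 2 := fun i =>
    setIntegral_sq_of_hasSum hL (summable_biotSavartCoef hL hw hp i) fun x => by
      simpa only [biotSavartTerm_eq] using hasSum_biotSavartTerm hL hw hp x i
  have hci : ∀ i, Continuous (fun x => biotSavart L w x i) := fun i =>
    Complex.continuous_re.comp (hi i).1
  have hcont : Continuous (biotSavart L w) := by
    have : biotSavart L w = fun x => WithLp.toLp 2 fun i => biotSavart L w x i := rfl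
    rw [this]
    exact (PiLp.continuous_toLp 2 _).comp (continuous_pi hci)
  have hmem : MemLp (biotSavart L w) 2 (volume.restrict (cell L)) := by
    rw [memLp_two_iff_integrable_sq_norm hcont.aestronglyMeasurable]
    exact integrableOn_cell (hcont.norm.pow 2)
  have hpars := hasSum_sq_fourierCoef hL hw.continuous hp
  have hwint : ∫ x in cell L, w x ^ 2 ≤ L ^ 2 * M ^ 2 := by
    calc ∫ x in cell L, w x ^ 2 ≤ ∫ _ in cell L, M ^ 2 :=
          integral_mono (integrableOn_cell (hw.continuous.pow 2))
            (integrable_const _) fun x => sq_le_sq' (by linarith [(abs_le.1 (hb x)).1])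
              (abs_le.1 (hb x)).2
      _ = L ^ 2 * M ^ 2 := by simp [volume_real_cell hL]
  have hbound : ∀ i, ∫ x in cell L, biotSavart L w x i ^ 2
      ≤ (L / (2 * Real.pi)) ^ 2 * (L ^ 2 * M ^ 2) := by
    intro i
    have hle : ∀ n, ‖biotSavartCoef L w i n‖ ^ 2
        ≤ (L / (2 * Real.pi)) ^ 2 * ‖fourierCoef L w n‖ ^ 2 := fun n => by
      rw [← mul_pow]
      exact pow_le_pow_left₀ (norm_nonneg _) (norm_biotSavartCoef_le hL w i n) 2
    have hsum := hpars.mul_left ((L / (2 * Real.pi)) ^ 2)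
    have hts := (Summable.of_nonneg_of_le (fun _ => by positivity) hle hsum.summable).tsum_le_tsum
      hle hsum.summable
    rw [hsum.tsum_eq] at hts
    have h := (hi i).2
    simp only [Complex.norm_real, Real.norm_eq_abs, sq_abs] at h
    rw [h]
    calc L ^ 2 * ∑' n, ‖biotSavartCoef L w i n‖ ^ 2
        ≤ L ^ 2 * ((L / (2 * Real.pi)) ^ 2 * ((L ^ 2)⁻¹ * ∫ x in cell L, w x ^ 2)) := by gcongr
      _ = (L / (2 * Real.pi)) ^ 2 * ∫ x in cell L, w x ^ 2 := by field_simp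
      _ ≤ _ := by gcongr
  refine ⟨hmem, ?_⟩
  rw [hmem.eLpNorm_eq_integral_rpow_norm (by norm_num) (by norm_num)]
  apply ENNReal.ofReal_le_ofReal
  have hint : ∫ x in cell L, ‖biotSavart L w x‖ ^ 2 ≤ (L ^ 2 * M) ^ 2 := by
    simp only [EuclideanSpace.norm_sq_eq, Fin.sum_univ_two, Real.norm_eq_abs, sq_abs]
    have hadd := integral_add (integrableOn_cell (L := L) ((hci 0).pow 2))
      (integrableOn_cell (L := L) ((hci 1).pow 2))
    simp only [Pi.pow_apply] at hadd
    rw [hadd]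
    -- Since `1 / (4π²) ≤ 1 / 2`, the two components together contribute at most `(L ^ 2 * M) ^ 2`.
    have h2 : (L / (2 * Real.pi)) ^ 2 ≤ L ^ 2 / 2 := by
      rw [div_pow]
      gcongr
      nlinarith
    have h3 := mul_le_mul_of_nonneg_right h2 (show 0 ≤ L ^ 2 * M ^ 2 by positivity)
    nlinarith [hbound 0, hbound 1]
  have hr : ∀ x, ‖biotSavart L w x‖ ^ (ENNReal.toReal 2) = ‖biotSavart L w x‖ ^ 2 := fun x => by
    norm_num
  simp only [hr]
  rw [ENNReal.toReal_ofNat, ← one_div, ← Real.sqrt_eq_rpow]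
  exact Real.sqrt_le_iff.2 ⟨by positivity, hint⟩

end BiotSavart

/-! ### Linearity of the operators and the two-sided sup-norm bound. -/

section Linearity

variable {F G : Plane → ℝ}

lemma pd_neg (F : Plane → ℝ) (i : Fin 2) : pd i (fun x => -F x) = fun x => -pd i F x := by
  funext x
  rw [pd, pd, fderiv_fun_neg]
  rfl

lemma pd_sub (hF : Differentiable ℝ F) (hG : Differentiable ℝ G) (i : Fin 2) :
    pd i (fun x => F x - G x) = fun x => pd i F x - pd i G x := by
  funext x
  rw [pd, pd, pd, fderiv_fun_sub (hF x) (hG x)]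
  rfl

lemma lap_neg (F : Plane → ℝ) (x : Plane) : lap (fun x => -F x) x = -lap F x := by
  simp [lap, pd_neg]

lemma advect_neg (v : Plane → Plane) (F : Plane → ℝ) (x : Plane) :
    advect v (fun x => -F x) x = -advect v F x := by
  simp [advect, pd_neg]

lemma lap_sub (hF : ContDiff ℝ 2 F) (hG : ContDiff ℝ 2 G) (x : Plane) :
    lap (fun x => F x - G x) x = lap F x - lap G x := by
  rw [lap, lap, lap, ← Finset.sum_sub_distrib]
  refine Finset.sum_congr rfl fun i _ => ?_
  rw [pd_sub (hF.differentiable (by norm_num)) (hG.differentiable (by norm_num)),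
    pd_sub ((contDiff_pd (n := 1) hF i).differentiable (by norm_num))
      ((contDiff_pd (n := 1) hG i).differentiable (by norm_num))]

lemma advect_sub (hF : Differentiable ℝ F) (hG : Differentiable ℝ G) (v : Plane → Plane)
    (x : Plane) : advect v (fun x => F x - G x) x = advect v F x - advect v G x := by
  rw [advect, advect, advect, ← Finset.sum_sub_distrib]
  refine Finset.sum_congr rfl fun i _ => ?_
  rw [pd_sub hF hG, mul_sub]

/-- The sup-norm bound for the backward linear problem on the torus with zero terminal value. -/
lemma abs_le_of_backward_parabolic {L a b M ν : ℝ} (hL : 0 < L) (hν : 0 ≤ ν) {v : Plane → Plane}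
    {D D' : ℝ → Plane → ℝ}
    (hc : ContinuousOn (fun z : ℝ × Plane => D z.1 z.2) (Icc a b ×ˢ univ))
    (hs : ∀ t ∈ Ico a b, ContDiff ℝ 2 (D t))
    (hp : ∀ t ∈ Icc a b, IsPeriodic L (D t))
    (hd : ∀ t ∈ Ico a b, ∀ x, HasDerivWithinAt (fun s => D s x) (D' t x) (Icc a b) t)
    (heq : ∀ t ∈ Ico a b, ∀ x, |D' t x - advect v (D t) x + ν * lap (D t) x| ≤ M)
    (hb : ∀ x, D b x = 0) {t : ℝ} (ht : t ∈ Icc a b) (x : Plane) : |D t x| ≤ M * (b - t) := by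
  refine abs_le'.2 ⟨le_of_backward_parabolic hL hν hc hs hp hd
    (fun t ht x => (abs_le.1 (heq t ht x)).1) (fun x => (hb x).le) ht x, ?_⟩
  refine le_of_backward_parabolic (v := v) (ν := ν) (D := fun t x => -D t x)
    (D' := fun t x => -D' t x) hL hν hc.neg (fun t ht => (hs t ht).neg)
    (fun t ht i x => congrArg Neg.neg (hp t ht i x)) (fun t ht x => (hd t ht x).neg)
    (fun t ht x => ?_) (fun x => by simp [hb x]) ht x
  rw [lap_neg, advect_neg]
  linarith [(abs_le.1 (heq t ht x)).2]

end Linearity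

/-! ### The error caused by freezing the velocity. -/

section FrozenVelocity

variable {σ L T : ℝ} {f : ℝ → Plane → Plane} {φ : Plane → Plane} {u : ℝ → Plane → Plane}
  {p : ℝ → Plane → ℝ}

/-- The time derivative of `u` is continuous on the slab and periodic in space, hence bounded; the
mean value inequality does the rest. -/
lemma IsNSSolution.exists_lipschitz_time (hL : 0 < L) (hT : 0 < T)
    (hu : IsNSSolution σ L T f φ u p) (i : Fin 2) :
    ∃ C, 0 ≤ C ∧ ∀ s ∈ Icc 0 T, ∀ t ∈ Icc 0 T, ∀ x, |u t x i - u s x i| ≤ C * |t - s| := by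
  have hUd := (hu.contDiffOn_coord i).differentiableOn (by norm_num)
  have hper : ∀ t ∈ Icc 0 T,
      IsPeriodic L (fun x => slabDeriv T (1, 0) (fun z => u z.1 z.2 i) (t, x)) := by
    intro t ht j x
    have hud := uniqueDiffOn_Icc hT t ht
    simp only
    rw [← (hasDerivWithinAt_slice hUd ht _).derivWithin hud,
      ← (hasDerivWithinAt_slice hUd ht x).derivWithin hud]
    exact derivWithin_congr (fun s hs => by simp only [hu.periodic_u s hs j x])
      (by simp only [hu.periodic_u t ht j x])
  obtain ⟨C, hC, hb⟩ := exists_bound_of_periodic hL (contDiffOn_slabDeriv hT (m := 2) (n := 3)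
    (hu.contDiffOn_coord i) le_rfl (1, 0)).continuousOn hper
  refine ⟨C, hC, fun s hs t ht x => ?_⟩
  exact (convex_Icc 0 T).norm_image_sub_le_of_norm_hasDerivWithin_le
    (fun r hr => hasDerivWithinAt_slice hUd hr x) (fun r hr => hb r hr x) hs ht

lemma IsNSSolution.exists_bound_pd_curl (hL : 0 < L) (hT : 0 < T)
    (hu : IsNSSolution σ L T f φ u p) (i : Fin 2) :
    ∃ C, 0 ≤ C ∧ ∀ t ∈ Icc 0 T, ∀ x, |pd i (curl (u t)) x| ≤ C := by
  have hWd := (hu.contDiffOn_slabVorticity hT).differentiableOn (by norm_num)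
  have hpdW : ∀ t ∈ Icc 0 T, pd i (curl (u t)) =
      fun y => slabDeriv T (0, basisVec i) (slabVorticity T u) (t, y) := by
    intro t ht
    rw [hu.curl_eq ht]
    exact funext fun y => pd_slice hWd ht y i
  obtain ⟨C, hC, hb⟩ := exists_bound_of_periodic hL (contDiffOn_slabDeriv hT (m := 1) (n := 2)
    (hu.contDiffOn_slabVorticity hT) le_rfl (0, basisVec i)).continuousOn
    (fun t ht => by rw [← hpdW t ht]; exact (hu.periodic_u t ht).curl.pd i)
  exact ⟨C, hC, fun t ht x => by rw [hpdW t ht]; exact hb t ht x⟩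

/-- The vorticity of the frozen-velocity problem is second-order accurate over one time step,
in the supremum norm. -/
lemma IsNSSolution.exists_vorticity_error (hL : 0 < L) (hT : 0 < T)
    (hu : IsNSSolution σ L T f φ u p) :
    ∃ C, 0 ≤ C ∧ ∀ a b, 0 ≤ a → b ≤ T → ∀ w : ℝ → Plane → ℝ,
      IsFrozenSolution σ L a b (u b) (fun t => curl (f t)) (curl (u b)) w →
      ∀ t ∈ Icc a b, ∀ x, |curl (u t) x - w t x| ≤ C * (b - a) ^ 2 := by
  choose A hA hA' using hu.exists_lipschitz_time hL hT
  choose B hB hB' using hu.exists_bound_pd_curl hL hT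
  have hAB : ∀ j, 0 ≤ A j * B j := fun j => mul_nonneg (hA j) (hB j)
  refine ⟨∑ j, A j * B j, Finset.sum_nonneg fun j _ => hAB j,
    fun a b ha hb w hw t ht x => ?_⟩
  have hsub : Icc a b ⊆ Icc 0 T := Icc_subset_Icc ha hb
  have hbT : b ∈ Icc 0 T := hsub ⟨ht.1.trans ht.2, le_rfl⟩
  have hba : 0 ≤ b - a := by linarith [ht.1, ht.2]
  have hCab : 0 ≤ (∑ j, A j * B j) * (b - a) :=
    mul_nonneg (Finset.sum_nonneg fun j _ => hAB j) hba
  have key := abs_le_of_backward_parabolic (a := a) (b := b) (M := (∑ j, A j * B j) * (b - a))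
    (ν := σ ^ 2 / 2) (v := u b) (D := fun t x => curl (u t) x - w t x)
    (D' := fun t x => slabDeriv T (1, 0) (slabVorticity T u) (t, x)
      - derivWithin (fun s => w s x) (Icc a b) t) hL (by positivity) ?_ ?_ ?_ ?_ ?_ ?_ ht x
  -- One factor `b - a` comes from the source, the other from the remaining time `b - t ≤ b - a`.
  · refine key.trans ?_
    rw [sq, ← mul_assoc]
    exact mul_le_mul_of_nonneg_left (by linarith [ht.1]) hCab
  · refine ContinuousOn.sub ?_ hw.continuous
    refine ((hu.contDiffOn_slabVorticity hT).continuousOn.mono (prod_mono_left hsub)).congr ?_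
    rintro ⟨s, y⟩ ⟨hs, -⟩
    simp only [hu.curl_eq (hsub hs)]
  · exact fun s hs => (hu.contDiff_curl hT (hsub (Ico_subset_Icc_self hs))).sub
      (hw.smooth_space s hs)
  · intro s hs i y
    simp only [(hu.periodic_u s (hsub hs)).curl i y, hw.periodic s hs i y]
  · exact fun s hs y => ((hu.hasDerivWithinAt_curl hT (hsub (Ico_subset_Icc_self hs)) y).mono
      hsub).sub (hw.smooth_time s hs y).hasDerivWithinAt
  · intro s hs y
    have hs' : s ∈ Icc 0 T := hsub (Ico_subset_Icc_self hs)
    have h1 := hu.vorticity_equation hT ⟨hs'.1, hs.2.trans_le hb⟩ y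
    have h2 := hw.equation s hs y
    have hcu := hu.contDiff_curl hT hs'
    have hcw := hw.smooth_space s hs
    rw [advect_sub (hcu.differentiable (by norm_num)) (hcw.differentiable (by norm_num)),
      lap_sub hcu hcw]
    -- The forcing `curl f` cancels, and the mismatch of the two advecting velocities becomes the
    -- source of the error equation.
    have h3 : slabDeriv T (1, 0) (slabVorticity T u) (s, y)
        - derivWithin (fun s => w s y) (Icc a b) s
        - (advect (u b) (curl (u s)) y - advect (u b) (w s) y)
        + σ ^ 2 / 2 * (lap (curl (u s)) y - lap (w s) y)
        = ∑ j, (u s y j - u b y j) * pd j (curl (u s)) y := by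
      simp only [sub_mul, Finset.sum_sub_distrib]
      change _ = advect (u s) (curl (u s)) y - advect (u b) (curl (u s)) y
      linear_combination h1 - h2
    rw [h3, Finset.sum_mul]
    refine (Finset.abs_sum_le_sum_abs _ _).trans (Finset.sum_le_sum fun j _ => ?_)
    have hsb : |s - b| ≤ b - a := by
      rw [abs_sub_comm, abs_of_nonneg (by linarith [hs.2])]
      linarith [hs.1]
    rw [abs_mul]
    calc |u s y j - u b y j| * |pd j (curl (u s)) y|
        ≤ (A j * |s - b|) * B j := mul_le_mul (hA' j b hbT s hs' y) (hB' j s hs' y)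
          (abs_nonneg _) (mul_nonneg (hA j) (abs_nonneg _))
      _ ≤ (A j * (b - a)) * B j := by
          have := hA j
          have := hB j
          gcongr
      _ = A j * B j * (b - a) := by ring
  · intro y
    rw [hw.terminal y, sub_self]

/-- At `t = b` the regularity comes from the terminal datum, since the equation is posed only for `t
< b`. -/
lemma IsFrozenSolution.contDiff {σ L a b : ℝ} {v : Plane → Plane} {g : ℝ → Plane → ℝ}
    {w₁ : Plane → ℝ} {w : ℝ → Plane → ℝ} (hw : IsFrozenSolution σ L a b v g w₁ w)
    (hw₁ : ContDiff ℝ 2 w₁) {t : ℝ} (ht : t ∈ Icc a b) : ContDiff ℝ 2 (w t) := by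
  rcases ht.2.eq_or_lt with rfl | h
  · rwa [funext hw.terminal]
  · exact hw.smooth_space t ⟨ht.1, h⟩

end FrozenVelocity

end PeriodicNS

/-! ### The velocity estimate over one step. -/

theorem mainTheorem12 (σ L T : ℝ) (hL : 0 < L) (hT : 0 < T)
    (f : ℝ → PeriodicNS.Plane → PeriodicNS.Plane) (φ : PeriodicNS.Plane → PeriodicNS.Plane)
    (u : ℝ → PeriodicNS.Plane → PeriodicNS.Plane) (p : ℝ → PeriodicNS.Plane → ℝ)
    (hu : PeriodicNS.IsNSSolution σ L T f φ u p) :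
    ∃ K : ℝ, 0 < K ∧ ∀ N : ℕ, 0 < N → ∀ k : ℕ, k < N →
      ∀ ω' : ℝ → PeriodicNS.Plane → ℝ,
        PeriodicNS.IsFrozenSolution σ L (PeriodicNS.gridTime T N k) (PeriodicNS.gridTime T N (k + 1))
          (u (PeriodicNS.gridTime T N (k + 1))) (fun t => PeriodicNS.curl (f t))
          (PeriodicNS.curl (u (PeriodicNS.gridTime T N (k + 1)))) ω' →
        ∀ t ∈ Set.Icc (PeriodicNS.gridTime T N k) (PeriodicNS.gridTime T N (k + 1)),
          (∀ (x : PeriodicNS.Plane) (i : Fin 2),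
            HasSum (fun n => PeriodicNS.biotSavartTerm L (ω' t) x n i)
              ((PeriodicNS.biotSavart L (ω' t) x i : ℝ) : ℂ)) ∧
          (∀ x : PeriodicNS.Plane,
            u t x - PeriodicNS.biotSavart L (ω' t) x =
              PeriodicNS.biotSavart L (fun y => PeriodicNS.curl (u t) y - ω' t y) x) ∧
          MeasureTheory.MemLp (fun x => u t x - PeriodicNS.biotSavart L (ω' t) x) 2
            (MeasureTheory.volume.restrict (PeriodicNS.cell L)) ∧
          MeasureTheory.eLpNorm (fun x => u t x - PeriodicNS.biotSavart L (ω' t) x) 2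
            (MeasureTheory.volume.restrict (PeriodicNS.cell L)) ≤
              ENNReal.ofReal (K * (T / N) ^ 2) := by
  obtain ⟨C, hC, hCb⟩ := hu.exists_vorticity_error hL hT
  -- The summand `1` only secures `K > 0`, as `C` may vanish.
  refine ⟨L ^ 2 * C + 1, by positivity, fun N hN k hk ω' hω t ht => ?_⟩
  have hN' : (0 : ℝ) < N := by exact_mod_cast hN
  have ha : 0 ≤ PeriodicNS.gridTime T N k := by rw [PeriodicNS.gridTime]; positivity
  have hb : PeriodicNS.gridTime T N (k + 1) ≤ T := by
    have hk' : ((k + 1 : ℕ) : ℝ) ≤ N := by exact_mod_cast hk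
    rw [PeriodicNS.gridTime]
    calc ((k + 1 : ℕ) : ℝ) * (T / N) ≤ N * (T / N) := by gcongr
      _ = T := by field_simp
  have hstep : PeriodicNS.gridTime T N (k + 1) - PeriodicNS.gridTime T N k = T / N := by
    rw [PeriodicNS.gridTime, PeriodicNS.gridTime]
    push_cast
    ring
  have htT : t ∈ Set.Icc 0 T := ⟨ha.trans ht.1, ht.2.trans hb⟩
  have hbT : PeriodicNS.gridTime T N (k + 1) ∈ Set.Icc 0 T := ⟨htT.1.trans ht.2, hb⟩
  have hcu := hu.contDiff_curl hT htT
  have hpu := (hu.periodic_u t htT).curl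
  have hcw := hω.contDiff (hu.contDiff_curl hT hbT) ht
  have hpw := hω.periodic t ht
  have hrec : ∀ x, PeriodicNS.biotSavart L (PeriodicNS.curl (u t)) x = u t x :=
    PeriodicNS.biotSavart_curl hL
      (fun i => (PeriodicNS.contDiff_slice (hu.contDiffOn_coord i) htT).of_le (by norm_num))
      hcu (hu.periodic_u t htT) (hu.div_free t htT) (hu.zero_mean t htT)
  have hdiff : ∀ x, u t x - PeriodicNS.biotSavart L (ω' t) x =
      PeriodicNS.biotSavart L (fun y => PeriodicNS.curl (u t) y - ω' t y) x := fun x => by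
    rw [PeriodicNS.biotSavart_sub hL hcu hcw hpu hpw, hrec]
  have hmem := PeriodicNS.memLp_biotSavart hL (hcu.sub hcw)
    (fun i x => congrArg₂ _ (hpu i x) (hpw i x))
    (mul_nonneg hC (sq_nonneg _)) (hCb _ _ ha hb ω' hω t ht)
  rw [hstep] at hmem
  refine ⟨PeriodicNS.hasSum_biotSavartTerm hL hcw hpw, hdiff, ?_, ?_⟩
  · rw [funext hdiff]
    exact hmem.1
  · rw [funext hdiff]
    refine hmem.2.trans (ENNReal.ofReal_le_ofReal ?_)
    nlinarith [sq_nonneg (T / N)]
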